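/- Let $q=p_1^{r_1}\cdots p_t^{r_t}$ ($t\ge 0$), where $p_1,\dots,p_t$ are distinct odd primes and $r_j\ge 1$. Put $P_j=p_j^{r_j}$, $n_j=P_1+\dots+P_j$ ($n_0=0$) and $n=n_t$. Let $B_n$ be the Artin braid group with standard generators $\sigma_1,\dots,\sigma_{n-1}$, $P_n$ the pure braid group (the kernel of $B_n\to S_n$, $\sigma_i\mapsto(i,i+1)$), and $\overline\sigma\colon B_n/[P_n,P_n]\to S_n$ the induced homomorphism. In $B_n/[P_n,P_n]$ put, for $1\le a<b\le n$ and $1\le j\le t$, $$A_{a,b}=\sigma_{b-1}\cdots\sigma_{a+1}\sigma_a^2\sigma_{a+1}^{-1}\cdots\sigma_{b-1}^{-1},\qquad \delta_{n_{j-1},P_j}=\sigma_{n_j-1}\cdots\sigma_{n_{j-1}+\frac{P_j+1}{2}}\,\sigma_{n_{j-1}+\frac{P_j-1}{2}}^{-1}\cdots\sigma_{n_{j-1}+1}^{-1},$$ $$\delta=\delta_{n_0,P_1}\cdots\delta_{n_{t-1},P_t},\qquad x_j=A_{n_{j-1}+1,\,n_{j-1}+2}\,\delta_{n_{j-1},P_j}.$$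 Let $\Gamma_q\le B_n/[P_n,P_n]$ be the subgroup generated by $x_1,\dots,x_t$ and all $A_{a,b}^{\,q}$ ($1\le a<b\le n$), and let $\mathbb Z_q\le S_n$ be the subgroup generated by $\overline\sigma(\delta)$. Let $\mathcal B$ be the family consisting of - $e_{j,0,1}=x_j^{P_j}$ and $e_{j,0,k+1}=\delta^{k-1}A_{n_{j-1}+2,\,n_{j-1}+3}^{\,q}\,\delta^{-(k-1)}$, for $1\le j\le t$, $1\le k\le P_j-1$; - $e_{j,h,k}=\delta^{k-1}A_{n_{j-1}+1,\,n_{j-1}+h+2}^{\,q}\,\delta^{-(k-1)}$, for $1\le j\le t$, $1\le h\le\frac{P_j-3}{2}$, $1\le k\le P_j$; - $f_{a,b,k}=\delta^{k-1}A_{n_{a-1}+1,\,n_{b-1}+1}^{\,q}\,\delta^{-(k-1)}$, for $1\le a<b\le t$, $1\le k\le P_aP_b$. Then $\mathbb Z_q$ is cyclic of order $q$, and $\overline\sigma$ restricts to a surjection in a short exact sequence $$1\to\mathbb Z^{\frac{n(n-1)}2}\to\Gamma_q\xrightarrow{\ \overline\sigma\ }\mathbb Z_q\to1$$ in which the standard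 basis of $\mathbb Z^{\frac{n(n-1)}2}$ is mapped bijectively onto the family $\mathcal B$ (so $\mathcal B$ is a basis of the kernel). Moreover $\Gamma_q$ has a presentation with generators the elements of $\mathcal B$ and $x_1,\dots,x_t$, and relations 1. any two elements of $\mathcal B$ commute, and $x_ix_j=x_jx_i$ for all $i,j$; 2. $x_j^{P_j}=e_{j,0,1}$ for $1\le j\le t$; 3. for $1\le j\le t$, with the index $k+1$ read modulo $P_j$, $$x_j\,e_{j,h,k}\,x_j^{-1}=\begin{cases}e_{j,0,1},&h=0,\ k=1,\\ e_{j,0,k+1},&h=0,\ 2\le k\le P_j-1,\\ e_{j,0,1}^{\,q}\prod_{l=1}^{P_j-1}e_{j,0,l+1}^{-1},&h=0,\ k=P_j,\\ e_{j,h,k+1},&1\le h\le\frac{P_j-3}{2},\ 1\le k\le P_j;\end{cases}$$ 4. $(x_ax_b)\,f_{a,b,k}\,(x_ax_b)^{-1}=f_{a,b,k+1}$ for $1\le a<b\le t$, $1\le k\le P_aP_b$, with $k+1$ read modulo $P_aP_b$; 5. $x_i\,e_{j,h,k}\,x_i^{-1}=e_{j,h,k}$ for $i\ne j$, and $x_i\,f_{a,b,k}\,x_i^{-1}=f_{a,b,k}$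 for $i\notin\{a,b\}$. -/

import Mathlib

namespace BraidBieberbach

/-- Defining relators of the Artin braid group on `n` strings. The standard generator
`σ_{i+1}` is the letter `i : Fin (n - 1)`. -/
def braidRelators (n : ℕ) : Set (FreeGroup (Fin (n - 1))) :=
  {w | ∃ i j : Fin (n - 1), (i : ℕ) + 2 ≤ (j : ℕ) ∧
      w = FreeGroup.of i * FreeGroup.of j * (FreeGroup.of j * FreeGroup.of i)⁻¹} ∪
  {w | ∃ i j : Fin (n - 1), (j : ℕ) = (i : ℕ) + 1 ∧
      w = FreeGroup.of j * FreeGroup.of i * FreeGroup.of j *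
        (FreeGroup.of i * FreeGroup.of j * FreeGroup.of i)⁻¹}

/-- The Artin braid group `B_n`. -/
abbrev BraidGroup (n : ℕ) : Type := PresentedGroup (braidRelators n)

/-- The transposition of the neighbours `i`, `i + 1` (counted from `0`). -/
def adjSwap (n : ℕ) (i : Fin (n - 1)) : Equiv.Perm (Fin n) :=
  Equiv.swap ⟨(i : ℕ), by omega⟩ ⟨(i : ℕ) + 1, by omega⟩

theorem adjSwap_relators (n : ℕ) :
    ∀ w ∈ braidRelators n, FreeGroup.lift (adjSwap n) w = 1 := by
  rintro w (⟨i, j, hij, rfl⟩ | ⟨i, j, hij, rfl⟩)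
  · rw [map_mul, map_inv, mul_inv_eq_one]
    simp only [map_mul, FreeGroup.lift_apply_of]
    refine (Equiv.Perm.Disjoint.commute ?_).eq
    unfold adjSwap
    rw [Equiv.Perm.disjoint_iff_disjoint_support, Equiv.Perm.support_swap (by simp),
      Equiv.Perm.support_swap (by simp)]
    simp only [Finset.disjoint_left, Finset.mem_insert, Finset.mem_singleton, Fin.ext_iff]
    intro x hx
    omega
  · rw [map_mul, map_inv, mul_inv_eq_one]
    simp only [map_mul, FreeGroup.lift_apply_of]
    have hj : adjSwap n j = Equiv.swap ⟨(i : ℕ) + 1, by omega⟩ ⟨(i : ℕ) + 2, by omega⟩ := by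
      simp only [adjSwap, hij]
    rw [hj]
    unfold adjSwap
    have key : ∀ x y z : Fin n, x ≠ y → x ≠ z → y ≠ z →
        Equiv.swap y z * Equiv.swap x y * Equiv.swap y z =
          Equiv.swap x y * Equiv.swap y z * Equiv.swap x y := by
      intro x y z hxy hxz hyz
      rw [Equiv.swap_mul_swap_mul_swap hxy hxz, Equiv.swap_comm x y, Equiv.swap_comm y z,
        Equiv.swap_mul_swap_mul_swap hyz.symm hxz.symm, Equiv.swap_comm]
    exact key _ _ _ (by simp) (by simp) (by simp)

/-- The projection `B_n → S_n`, `σ_i ↦ (i, i+1)`. -/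
def braidPerm (n : ℕ) : BraidGroup n →* Equiv.Perm (Fin n) :=
  PresentedGroup.toGroup (adjSwap_relators n)

/-- The pure braid group `P_n`. -/
def pureBraid (n : ℕ) : Subgroup (BraidGroup n) := (braidPerm n).ker

instance (n : ℕ) : (pureBraid n).Normal := by
  unfold pureBraid; infer_instance

/-- The quotient `B_n / [P_n, P_n]`. -/
abbrev BraidQuot (n : ℕ) : Type := BraidGroup n ⧸ ⁅pureBraid n, pureBraid n⁆

/-- The homomorphism `B_n / [P_n, P_n] → S_n` induced by `braidPerm`. -/
def permBar (n : ℕ) : BraidQuot n →* Equiv.Perm (Fin n) :=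
  QuotientGroup.lift _ (braidPerm n)
    (show ⁅pureBraid n, pureBraid n⁆ ≤ pureBraid n from Subgroup.commutator_le_left _ _)

/-- The class of `σ_i` in `B_n / [P_n, P_n]`, for `1 ≤ i ≤ n - 1` (and `1` outside that range). -/
def sig (n i : ℕ) : BraidQuot n :=
  if h : 1 ≤ i ∧ i < n then
    QuotientGroup.mk (PresentedGroup.of (⟨i - 1, by omega⟩ : Fin (n - 1)))
  else 1

/-- The descending product `f b * f (b - 1) * ⋯ * f a` (empty if `b < a`). -/
def descProd {G : Type*} [Group G] (f : ℕ → G) (a b : ℕ) : G :=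
  ((List.range' a (b + 1 - a)).reverse.map f).prod

/-- `A_{i,j} = σ_{j-1} ⋯ σ_{i+1} σ_i² σ_{i+1}⁻¹ ⋯ σ_{j-1}⁻¹`, for `1 ≤ i < j ≤ n`. -/
def pureGen (n i j : ℕ) : BraidQuot n :=
  descProd (sig n) (i + 1) (j - 1) * sig n i ^ 2 * (descProd (sig n) (i + 1) (j - 1))⁻¹

/-- `δ_{m,z} = σ_{m+z-1} ⋯ σ_{m+(z+1)/2} σ_{m+(z-1)/2}⁻¹ ⋯ σ_{m+1}⁻¹`, for odd `z`. -/
def deltaBlock (n m z : ℕ) : BraidQuot n :=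
  descProd (sig n) (m + (z + 1) / 2) (m + z - 1) *
    descProd (fun i => (sig n i)⁻¹) (m + 1) (m + (z - 1) / 2)

section Blocks

/- `P j` is the prime power of block `j`; blocks are counted from `0`. -/
variable {t : ℕ} (P : Fin t → ℕ)

/-- The number of strings, `n = ∑ P_j`. -/
def strands : ℕ := ∑ j, P j

/-- `q = ∏ P_j`. -/
def order : ℕ := ∏ j, P j

/-- The number of strings in the blocks that precede block `j`. -/
def offset (j : Fin t) : ℕ := ∑ i ∈ Finset.Iio j, P i

/-- The rank `n (n - 1) / 2`. -/
def latticeRank : ℕ := strands P * (strands P - 1) / 2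

/-- `δ_{m,P_j}`, where `m` is the offset of block `j`. -/
def delta (j : Fin t) : BraidQuot (strands P) :=
  deltaBlock (strands P) (offset P j) (P j)

/-- The product of the elements `delta j`, in increasing order of `j`. -/
def deltaTotal : BraidQuot (strands P) := (List.ofFn (delta P)).prod

/-- `x_j = A_{m+1,m+2} δ_{m,P_j}`, where `m` is the offset of block `j`. -/
def rotElt (j : Fin t) : BraidQuot (strands P) :=
  pureGen (strands P) (offset P j + 1) (offset P j + 2) * delta P j

/-- The group `Γ_q`: the subgroup of `B_n / [P_n, P_n]` generated by the elements `x_j` and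
by the powers `A_{a,b}^q`, `1 ≤ a < b ≤ n`. -/
def Gamma : Subgroup (BraidQuot (strands P)) :=
  Subgroup.closure (Set.range (rotElt P) ∪
    {g | ∃ a b : ℕ, 1 ≤ a ∧ a < b ∧ b ≤ strands P ∧ g = pureGen (strands P) a b ^ order P})

/-- The subgroup `ℤ_q` of `S_n`, generated by the permutation of `δ`. -/
def holonomy : Subgroup (Equiv.Perm (Fin (strands P))) :=
  Subgroup.zpowers (permBar (strands P) (deltaTotal P))

/-- `δ^s g^q δ^{-s}`. -/
def deltaConj (s : ℕ) (g : BraidQuot (strands P)) : BraidQuot (strands P) :=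
  deltaTotal P ^ s * g ^ order P * (deltaTotal P ^ s)⁻¹

/-- Indices of the lattice generators.
`inner j h k` stands for `e_{j,h,k+1}`, with `0 ≤ h ≤ (P_j - 3)/2` and `1 ≤ k + 1 ≤ P_j`.
`cross a b _ k`, `a < b`, stands for the `(k+1)`-st generator, `1 ≤ k + 1 ≤ P_a P_b`, of the
family of the pair of blocks `a`, `b`. -/
inductive LatticeIndex : Type
  | inner (j : Fin t) (h : Fin ((P j - 1) / 2)) (k : Fin (P j)) : LatticeIndex
  | cross (a b : Fin t) (hab : a < b) (k : Fin (P a * P b)) : LatticeIndex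

/-- The lattice generators, as elements of `B_n / [P_n, P_n]`. -/
def latticeElt : LatticeIndex P → BraidQuot (strands P)
  | .inner j h k =>
      if (h : ℕ) = 0 then
        if (k : ℕ) = 0 then rotElt P j ^ P j
        else deltaConj P ((k : ℕ) - 1)
          (pureGen (strands P) (offset P j + 2) (offset P j + 3))
      else deltaConj P (k : ℕ)
        (pureGen (strands P) (offset P j + 1) (offset P j + (h : ℕ) + 2))
  | .cross a b _ k =>
      deltaConj P (k : ℕ) (pureGen (strands P) (offset P a + 1) (offset P b + 1))

/-- The generating symbols of the presentation. -/
abbrev PresGen : Type := LatticeIndex P ⊕ Fin t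

/-- The letter of a lattice generator. -/
def symE (i : LatticeIndex P) : FreeGroup (PresGen P) := FreeGroup.of (Sum.inl i)

/-- The letter of `x_j`. -/
def symX (j : Fin t) : FreeGroup (PresGen P) := FreeGroup.of (Sum.inr j)

/-- `PresRel P u v`: the relation `u = v` belongs to the presentation.
`finRotate N k` is `k + 1` modulo `N`. -/
inductive PresRel : FreeGroup (PresGen P) → FreeGroup (PresGen P) → Prop
  /-- The lattice generators commute. -/
  | lattice_comm (i i' : LatticeIndex P) :
      PresRel (symE P i * symE P i') (symE P i' * symE P i)
  /-- The `x_j` commute. -/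
  | rot_comm (i j : Fin t) :
      PresRel (symX P i * symX P j) (symX P j * symX P i)
  /-- `x_j ^ P_j = e_{j,0,1}`. -/
  | power (j : Fin t) (h : Fin ((P j - 1) / 2)) (k : Fin (P j))
      (hh : (h : ℕ) = 0) (hk : (k : ℕ) = 0) :
      PresRel (symX P j ^ P j) (symE P (.inner j h k))
  /-- `x_j` centralizes `e_{j,0,1}`. -/
  | conj_first (j : Fin t) (h : Fin ((P j - 1) / 2)) (k : Fin (P j))
      (hh : (h : ℕ) = 0) (hk : (k : ℕ) = 0) :
      PresRel (symX P j * symE P (.inner j h k) * (symX P j)⁻¹) (symE P (.inner j h k))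
  /-- `x_j` maps `e_{j,0,k}` to `e_{j,0,k+1}` for `2 ≤ k ≤ P_j - 1`. -/
  | conj_zero (j : Fin t) (h : Fin ((P j - 1) / 2)) (k : Fin (P j))
      (hh : (h : ℕ) = 0) (hk : 1 ≤ (k : ℕ)) (hk' : (k : ℕ) + 1 < P j) :
      PresRel (symX P j * symE P (.inner j h k) * (symX P j)⁻¹)
        (symE P (.inner j h (finRotate (P j) k)))
  /-- `x_j` maps `e_{j,0,P_j}` to `e_{j,0,1}^q e_{j,0,2}⁻¹ ⋯ e_{j,0,P_j}⁻¹`. -/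
  | conj_last (j : Fin t) (h : Fin ((P j - 1) / 2)) (k k₀ : Fin (P j))
      (hh : (h : ℕ) = 0) (hk : (k : ℕ) + 1 = P j) (hk₀ : (k₀ : ℕ) = 0) :
      PresRel (symX P j * symE P (.inner j h k) * (symX P j)⁻¹)
        (symE P (.inner j h k₀) ^ order P *
          (((List.finRange (P j)).filter (fun l : Fin (P j) => decide (0 < (l : ℕ)))).map
            (fun l : Fin (P j) => (symE P (.inner j h l))⁻¹)).prod)
  /-- `x_j` maps `e_{j,h,k}` to `e_{j,h,k+1}` for `1 ≤ h`. -/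
  | conj_pos (j : Fin t) (h : Fin ((P j - 1) / 2)) (k : Fin (P j)) (hh : 1 ≤ (h : ℕ)) :
      PresRel (symX P j * symE P (.inner j h k) * (symX P j)⁻¹)
        (symE P (.inner j h (finRotate (P j) k)))
  /-- `x_a x_b` shifts the family of the pair of blocks `a < b`. -/
  | conj_cross (a b : Fin t) (hab : a < b) (k : Fin (P a * P b)) :
      PresRel (symX P a * symX P b * symE P (.cross a b hab k) * (symX P a * symX P b)⁻¹)
        (symE P (.cross a b hab (finRotate (P a * P b) k)))
  /-- `x_i` centralizes the lattice generators of the other blocks. -/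
  | conj_inner_other (i j : Fin t) (hij : i ≠ j) (h : Fin ((P j - 1) / 2)) (k : Fin (P j)) :
      PresRel (symX P i * symE P (.inner j h k) * (symX P i)⁻¹) (symE P (.inner j h k))
  /-- `x_i` centralizes the lattice generators of the pairs that do not contain `i`. -/
  | conj_cross_other (i a b : Fin t) (hab : a < b) (hia : i ≠ a) (hib : i ≠ b)
      (k : Fin (P a * P b)) :
      PresRel (symX P i * symE P (.cross a b hab k) * (symX P i)⁻¹) (symE P (.cross a b hab k))

/-- The relators `u v⁻¹` of the presentation. -/
def presRelators : Set (FreeGroup (PresGen P)) :=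
  {w | ∃ u v, PresRel P u v ∧ w = u * v⁻¹}

end Blocks

end BraidBieberbach

/-! The proof replaces computations with braids by computations with pairs of strings. The
assignment that sends `σ_i` to the characteristic function of the pair `{i - 1, i}` (strings counted
from `0`), together with the permutation, satisfies the braid relations in the semidirect product of
`ℤ^pairs` by `S_n`. It therefore yields a crossed homomorphism `crossing` on `B_n / [P_n, P_n]`. The
image of `P_n` is abelian and generated by the `A_{a,b}` (`mem_pureGenClosure`), and `A_{a,b}` has
crossing function twice the indicator of its pair. Hence an element is determined by its permutation
and its crossing function (`eq_of_crossing_eq`), and every identity needed below is checked on these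
two invariants.

Identify block `j` with `ZMod (P j)`. Then `δ` and `x_j` act by translations: `δ` subtracts `1` in
every block, `x_j` only in block `j`. The orbits of `δ` on pairs are the pairs of one block at a
given cyclic distance `1, …, (P_j - 1)/2`, and, by the Chinese remainder theorem, all pairs joining
two given blocks. So the lattice symbols correspond bijectively to the pairs (`pairOf_injective`,
`exists_pairOf`). The signs in `δ` make its crossings cancel over a full rotation
(`sum_act_crossing_delta`), so `x_j^{P_j}` has crossing function `2` on each adjacent pair of block
`j`, while every other lattice generator is `2q` times the indicator of its own pair. This gives
linear independence, and the last conjugation relation is the only one in which the exceptional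
generator `x_j^{P_j}` has to be compensated.

For the presentation, let `L` be the subgroup of the presented group generated by the lattice
symbols. The relations make it abelian and normal, with every element of the group in `L · ∏
x_j^{f_j}`. An element acting trivially on the strings has `P_j ∣ f_j`, hence lies in `L`. Since `L`
is generated by commuting symbols with independent images, the map to `B_n / [P_n, P_n]` is
injective (`toBraid_injective`). Its image is `Γ_q`, because each `A_{a,b}^q` is a lattice generator
or the `x_j`-conjugate of one. -/

namespace BraidBieberbach

/-! ### Descending products -/

section DescProd

variable {G : Type*} [Group G]

theorem descProd_of_lt (f : ℕ → G) {a b : ℕ} (h : b < a) : descProd f a b = 1 := by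
  simp [descProd, show b + 1 - a = 0 by omega]

theorem descProd_succ_top (f : ℕ → G) {a b : ℕ} (h : a ≤ b + 1) :
    descProd f a (b + 1) = f (b + 1) * descProd f a b := by
  unfold descProd
  rw [show b + 1 + 1 - a = (b + 1 - a) + 1 by omega, List.range'_concat]
  simp [show a + (b + 1 - a) = b + 1 by omega]

theorem descProd_mul (f : ℕ → G) {a c b : ℕ} (hac : a ≤ c + 1) (hcb : c ≤ b) :
    descProd f (c + 1) b * descProd f a c = descProd f a b := by
  induction b, hcb using Nat.le_induction with
  | base => rw [descProd_of_lt f (Nat.lt_succ_self c), one_mul]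
  | succ b hb ih =>
    rw [descProd_succ_top f (by omega), descProd_succ_top f (by omega : a ≤ b + 1), mul_assoc, ih]

theorem descProd_self (f : ℕ → G) (a : ℕ) : descProd f a a = f a := by
  simp [descProd]

theorem descProd_bot (f : ℕ → G) {a b : ℕ} (h : a ≤ b) :
    descProd f a b = descProd f (a + 1) b * f a := by
  rw [← descProd_mul f (Nat.le_succ a) h, descProd_self]

theorem descProd_congr {f g : ℕ → G} {a b : ℕ} (h : ∀ i, a ≤ i → i ≤ b → f i = g i) :
    descProd f a b = descProd g a b := by
  unfold descProd
  congr 1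
  apply List.map_congr_left
  intro i hi
  rw [List.mem_reverse, List.mem_range'_1] at hi
  exact h i hi.1 (by omega)

theorem descProd_mem (S : Subgroup G) {f : ℕ → G} {a b : ℕ} (h : ∀ i, a ≤ i → i ≤ b → f i ∈ S) :
    descProd f a b ∈ S := by
  unfold descProd
  apply Subgroup.list_prod_mem
  intro x hx
  rw [List.mem_map] at hx
  obtain ⟨i, hi, rfl⟩ := hx
  rw [List.mem_reverse, List.mem_range'_1] at hi
  exact h i hi.1 (by omega)

theorem commute_descProd {g : G} {f : ℕ → G} {a b : ℕ}
    (h : ∀ i, a ≤ i → i ≤ b → Commute g (f i)) : Commute g (descProd f a b) := by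
  have := descProd_mem (Subgroup.centralizer {g}) (f := f) (a := a) (b := b) fun i hi hi' => by
    rw [Subgroup.mem_centralizer_singleton_iff]
    exact (h i hi hi').eq.symm
  rw [Subgroup.mem_centralizer_singleton_iff] at this
  exact Commute.symm this

end DescProd

/-! ### Braid sequences and the symmetric group as a Coxeter group -/

/-- `s 1, …, s (n - 1)` satisfy the braid relations. -/
structure IsBraidSeq {G : Type*} [Group G] (n : ℕ) (s : ℕ → G) : Prop where
  comm : ∀ i j, 1 ≤ i → i + 2 ≤ j → j < n → Commute (s i) (s j)
  braid : ∀ i, 1 ≤ i → i + 1 < n → s (i + 1) * s i * s (i + 1) = s i * s (i + 1) * s i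

/-- `s i` permutes the numbers below `n` as the transposition of `i - 1` and `i`. -/
def ActsByNeighbours {G : Type*} [Group G] (n : ℕ) (p : G →* Equiv.Perm (Fin n)) (s : ℕ → G) :
    Prop :=
  ∀ i, 1 ≤ i → i < n → ∀ x : Fin n,
    (p (s i) x : ℕ) = if (x : ℕ) = i - 1 then i else if (x : ℕ) = i then i - 1 else x

section Coxeter

variable {G : Type*} [Group G] {n : ℕ} {s : ℕ → G}

theorem IsBraidSeq.commute (hs : IsBraidSeq n s) {i j : ℕ} (hi : 1 ≤ i) (hj : 1 ≤ j) (hin : i < n)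
    (hjn : j < n) (h : i + 2 ≤ j ∨ j + 2 ≤ i) : Commute (s i) (s j) := by
  rcases h with h | h
  · exact hs.comm i j hi h hjn
  · exact (hs.comm j i hj h hin).symm

/-- A generator passes through a descending run by one braid relation at its own place and far
commutations elsewhere; its index drops by one. -/
theorem IsBraidSeq.descProd_mul_gen (hs : IsBraidSeq n s) {a b i : ℕ} (ha : 1 ≤ a) (hi : a < i)
    (hib : i ≤ b) (hb : b < n) : descProd s a b * s i = s (i - 1) * descProd s a b := by
  obtain ⟨k, rfl⟩ : ∃ k, i = k + 1 := ⟨i - 1, by omega⟩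
  rw [← descProd_mul s (c := k + 1) (by omega) hib, descProd_succ_top s (by omega : a ≤ k + 1)]
  obtain ⟨l, rfl⟩ : ∃ l, k = l + 1 := ⟨k - 1, by omega⟩
  rw [descProd_succ_top s (by omega : a ≤ l + 1)]
  have h1 : Commute (s (l + 1 + 1)) (descProd s a l) :=
    commute_descProd fun j hj hj' => hs.commute (by omega) (by omega) (by omega) (by omega)
      (by omega)
  have h2 : Commute (s (l + 1)) (descProd s (l + 1 + 1 + 1) b) :=
    commute_descProd fun j hj hj' => hs.commute (by omega) (by omega) (by omega) (by omega)
      (by omega)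
  have h3 := hs.braid (l + 1) (by omega) (by omega)
  have h1' := h1.eq
  have h2' := h2.eq
  simp only [Nat.add_sub_cancel]
  generalize descProd s a l = A at *
  generalize descProd s (l + 1 + 1 + 1) b = B at *
  calc B * (s (l + 1 + 1) * (s (l + 1) * A)) * s (l + 1 + 1)
      = B * s (l + 1 + 1) * s (l + 1) * (A * s (l + 1 + 1)) := by group
    _ = B * (s (l + 1 + 1) * s (l + 1) * s (l + 1 + 1)) * A := by rw [← h1']; group
    _ = (B * s (l + 1)) * s (l + 1 + 1) * s (l + 1) * A := by rw [h3]; group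
    _ = _ := by rw [← h2']; group

/-- The permutation of `s b * ⋯ * s a`. -/
theorem perm_descProd {p : G →* Equiv.Perm (Fin n)} (hp : ActsByNeighbours n p s) {a b : ℕ}
    (ha : 1 ≤ a) (hab : a ≤ b + 1) (hb : b < n) (x : Fin n) :
    (p (descProd s a b) x : ℕ) =
      if (x : ℕ) = a - 1 then b else if a ≤ (x : ℕ) ∧ (x : ℕ) ≤ b then (x : ℕ) - 1 else x := by
  have hab' : a - 1 ≤ b := by omega
  induction b, hab' using Nat.le_induction with
  | base =>
    rw [descProd_of_lt s (by omega)]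
    simp only [map_one, Equiv.Perm.coe_one, id_eq]
    split_ifs <;> omega
  | succ b hb' ih =>
    rw [descProd_succ_top s (by omega), map_mul, Equiv.Perm.mul_apply, hp _ (by omega) hb,
      ih (by omega) (by omega)]
    split_ifs <;> omega

theorem closure_fixes {p : G →* Equiv.Perm (Fin n)} (hp : ActsByNeighbours n p s) {m : ℕ}
    (_ : m ≤ n) {g : G} (hg : g ∈ Subgroup.closure {x | ∃ i, 1 ≤ i ∧ i < m ∧ x = s i})
    (x : Fin n) (hx : m ≤ (x : ℕ)) : p g x = x := by
  have : Subgroup.closure {x | ∃ i, 1 ≤ i ∧ i < m ∧ x = s i} ≤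
      (MulAction.stabilizer (Equiv.Perm (Fin n)) x).comap p := by
    rw [Subgroup.closure_le]
    rintro _ ⟨i, hi, him, rfl⟩
    simp only [Subgroup.coe_comap, Set.mem_preimage, SetLike.mem_coe, MulAction.mem_stabilizer_iff,
      Equiv.Perm.smul_def]
    apply Fin.ext
    rw [hp i hi (by omega)]
    split_ifs <;> omega
  exact this hg

/-- The usual coset representatives of `S_{m-1}` in `S_m`: the set of products `u * s_{m-1} ⋯ s_k`
contains `1` and is stable under right multiplication by generators. -/
theorem exists_coset_rep (hs : IsBraidSeq n s) (hsq : ∀ i, 1 ≤ i → i < n → s i * s i = 1) {m : ℕ}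
    (hm : 1 ≤ m) (hmn : m ≤ n) {g : G}
    (hg : g ∈ Subgroup.closure {x | ∃ i, 1 ≤ i ∧ i < m ∧ x = s i}) :
    ∃ u ∈ Subgroup.closure {x | ∃ i, 1 ≤ i ∧ i < m - 1 ∧ x = s i}, ∃ k, 1 ≤ k ∧ k ≤ m ∧
      g = u * descProd s k (m - 1) := by
  have step : ∀ i, 1 ≤ i → i < m → ∀ g : G,
      (∃ u ∈ Subgroup.closure {x | ∃ i, 1 ≤ i ∧ i < m - 1 ∧ x = s i}, ∃ k, 1 ≤ k ∧ k ≤ m ∧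
        g = u * descProd s k (m - 1)) →
      ∃ u ∈ Subgroup.closure {x | ∃ i, 1 ≤ i ∧ i < m - 1 ∧ x = s i}, ∃ k, 1 ≤ k ∧ k ≤ m ∧
        g * s i = u * descProd s k (m - 1) := by
    rintro i hi him _ ⟨u, hu, k, hk, hkm, rfl⟩
    -- If `i < k - 1`, then `s i` commutes into `u`; if `i = k - 1`, it lengthens the run; if `i =
    -- k`, it cancels the last letter; if `i > k`, it passes through as `s (i - 1)`.
    rcases lt_trichotomy i k with h | rfl | h
    · rcases Nat.lt_or_ge (i + 1) k with h' | h'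
      · refine ⟨u * s i, mul_mem hu (Subgroup.subset_closure ⟨i, hi, by omega, rfl⟩), k, hk, hkm, ?_⟩
        rw [mul_assoc, mul_assoc, (commute_descProd (g := s i) fun j hj hj' =>
          hs.commute hi (by omega) (by omega) (by omega) (by omega)).eq]
      · obtain rfl : k = i + 1 := by omega
        exact ⟨u, hu, i, hi, by omega, by rw [descProd_bot s (a := i) (by omega), mul_assoc]⟩
    · refine ⟨u, hu, i + 1, by omega, by omega, ?_⟩
      rw [descProd_bot s (a := i) (by omega), mul_assoc, mul_assoc, hsq i hi (by omega), mul_one]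
    · refine ⟨u * s (i - 1), mul_mem hu (Subgroup.subset_closure ⟨i - 1, by omega, by omega, rfl⟩),
        k, hk, hkm, ?_⟩
      rw [mul_assoc, hs.descProd_mul_gen hk h (by omega) (by omega), mul_assoc]
  induction hg using Subgroup.closure_induction_right with
  | one => exact ⟨1, one_mem _, m, hm, le_rfl, by rw [descProd_of_lt s (by omega), one_mul]⟩
  | mul_right x hx y hy ih =>
    obtain ⟨i, hi, him, rfl⟩ := hy
    exact step i hi him x ih
  | mul_inv_cancel x hx y hy ih =>
    obtain ⟨i, hi, him, rfl⟩ := hy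
    rw [inv_eq_of_mul_eq_one_right (hsq i hi (by omega))]
    exact step i hi him x ih

/-- Faithfulness of the permutation representation of the Coxeter group of type `A`. -/
theorem eq_one_of_perm_eq_one (hs : IsBraidSeq n s) (hsq : ∀ i, 1 ≤ i → i < n → s i * s i = 1)
    {p : G →* Equiv.Perm (Fin n)} (hp : ActsByNeighbours n p s) {m : ℕ} (hmn : m ≤ n) {g : G}
    (hg : g ∈ Subgroup.closure {x | ∃ i, 1 ≤ i ∧ i < m ∧ x = s i}) (hpg : p g = 1) : g = 1 := by
  induction m generalizing g with
  | zero => simpa using hg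
  | succ m ih =>
    obtain ⟨u, hu, k, hk, hkm, rfl⟩ := exists_coset_rep hs hsq (by omega) hmn hg
    simp only [Nat.add_sub_cancel] at *
    have h1 : (p (descProd s k m) ⟨k - 1, by omega⟩ : ℕ) = m := by
      rw [perm_descProd hp hk hkm (by omega)]; simp
    -- The run carries `k - 1` to `m` and `u` fixes `m`, so a trivial permutation forces an empty
    -- run.
    have h2 := DFunLike.congr_fun hpg (⟨k - 1, by omega⟩ : Fin n)
    rw [map_mul, Equiv.Perm.mul_apply, closure_fixes hp (by omega) hu _ h1.ge,
      Equiv.Perm.one_apply, Fin.ext_iff, h1] at h2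
    obtain rfl : k = m + 1 := by simp only at h2; omega
    rw [descProd_of_lt s (by omega), mul_one] at hpg ⊢
    exact ih (by omega) hu hpg

end Coxeter

/-! ### A normality criterion -/

section NormalClosure

variable {G : Type*} [Group G]

/-- A subgroup that is stable under conjugation by the members of a generating set, each of which
has a power in the subgroup, is normal. -/
theorem normal_of_conj_gens {N : Subgroup G} {S T : Set G} (hN : N = Subgroup.closure S)
    (hT : Subgroup.closure T = ⊤)
    (hconj : ∀ g ∈ T, ∀ s ∈ S, g * s * g⁻¹ ∈ N) (hpow : ∀ g ∈ T, ∃ k : ℕ, g ^ (k + 1) ∈ N) :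
    N.Normal := by
  have hstab : ∀ g ∈ T, ∀ x ∈ N, g * x * g⁻¹ ∈ N := by
    intro g hg x hx
    have : N ≤ N.comap (MulAut.conj g).toMonoidHom := by
      conv_lhs => rw [hN]
      rw [Subgroup.closure_le]
      intro s hs
      simpa using hconj g hg s hs
    simpa using this hx
  have hpows : ∀ g ∈ T, ∀ k : ℕ, ∀ x ∈ N, g ^ k * x * (g ^ k)⁻¹ ∈ N := by
    intro g hg k
    induction k with
    | zero => intro x hx; simpa using hx
    | succ k ih =>
      intro x hx
      have := ih _ (hstab g hg x hx)
      rw [pow_succ]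
      convert this using 1
      group
  -- Conjugation by `g⁻¹` is conjugation by `g ^ k` after conjugation by `(g ^ (k + 1))⁻¹`, which
  -- lies in `N`.
  have hinv : ∀ g ∈ T, ∀ x ∈ N, g⁻¹ * x * g ∈ N := by
    intro g hg x hx
    obtain ⟨k, hk⟩ := hpow g hg
    have := hpows g hg k _ (mul_mem (mul_mem (inv_mem hk) hx) hk)
    convert this using 1
    rw [pow_succ]
    group
  rw [← Subgroup.normalizer_eq_top_iff, eq_top_iff, ← hT, Subgroup.closure_le]
  intro g hg
  rw [SetLike.mem_coe, Subgroup.mem_normalizer_iff]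
  refine fun x => ⟨hstab g hg x, fun hx => ?_⟩
  have := hinv g hg _ hx
  convert this using 1
  group

end NormalClosure

/-! ### Generators of the image of the pure braid group -/

section Relations

variable {n : ℕ}

theorem sig_eq {i : ℕ} (h1 : 1 ≤ i) (h2 : i < n) :
    sig n i = QuotientGroup.mk (PresentedGroup.of (⟨i - 1, by omega⟩ : Fin (n - 1))) :=
  dif_pos ⟨h1, h2⟩

theorem isBraidSeq_sig : IsBraidSeq n (sig n) where
  comm i j hi hij hj := by
    rw [sig_eq hi (by omega), sig_eq (by omega) hj]
    refine Commute.map ?_ (QuotientGroup.mk' ⁅pureBraid n, pureBraid n⁆)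
    have := PresentedGroup.mk_eq_mk_of_mul_inv_mem (rels := braidRelators n)
      (Or.inl ⟨⟨i - 1, by omega⟩, ⟨j - 1, by omega⟩, by simp only; omega, rfl⟩)
    exact this
  braid i hi hij := by
    rw [sig_eq hi (by omega), sig_eq (by omega) hij]
    have := PresentedGroup.mk_eq_mk_of_mul_inv_mem (rels := braidRelators n)
      (Or.inr ⟨⟨i - 1, by omega⟩, ⟨i + 1 - 1, by omega⟩, by simp only; omega, rfl⟩)
    exact congrArg (QuotientGroup.mk' ⁅pureBraid n, pureBraid n⁆) this

theorem actsByNeighbours_permBar : ActsByNeighbours n (permBar n) (sig n) := by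
  intro i hi hin x
  have : permBar n (sig n i) = adjSwap n ⟨i - 1, by omega⟩ := by
    rw [sig_eq hi hin]
    exact PresentedGroup.toGroup.of (adjSwap_relators n)
  rw [this, adjSwap, Equiv.swap_apply_def]
  simp only [Fin.ext_iff]
  split_ifs <;> (try simp only) <;> omega

theorem closure_sig : Subgroup.closure {x | ∃ i, 1 ≤ i ∧ i < n ∧ x = sig n i} = ⊤ := by
  rw [eq_top_iff]
  rintro g -
  obtain ⟨b, rfl⟩ := QuotientGroup.mk_surjective g
  have := PresentedGroup.generated_by (braidRelators n)
    ((Subgroup.closure {x | ∃ i, 1 ≤ i ∧ i < n ∧ x = sig n i}).comap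
      (QuotientGroup.mk' ⁅pureBraid n, pureBraid n⁆)) (fun j => by
        refine Subgroup.subset_closure ⟨j + 1, by omega, by omega, ?_⟩
        rw [sig_eq (by omega) (by omega)]
        rfl) b
  exact this

theorem commute_of_permBar_eq_one {g h : BraidQuot n} (hg : permBar n g = 1)
    (hh : permBar n h = 1) : Commute g h := by
  obtain ⟨a, rfl⟩ := QuotientGroup.mk_surjective g
  obtain ⟨b, rfl⟩ := QuotientGroup.mk_surjective h
  have ha : a ∈ pureBraid n := hg
  have hb : b ∈ pureBraid n := hh
  have := (QuotientGroup.eq_one_iff (N := ⁅pureBraid n, pureBraid n⁆) _).2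
    (Subgroup.commutator_mem_commutator ha hb)
  rw [commutatorElement_def, QuotientGroup.mk_mul, QuotientGroup.mk_mul, QuotientGroup.mk_mul,
    QuotientGroup.mk_inv, QuotientGroup.mk_inv, mul_inv_eq_one, mul_inv_eq_iff_eq_mul] at this
  exact this

theorem permBar_sig_sq {i : ℕ} (hi : 1 ≤ i) (hin : i < n) : permBar n (sig n i ^ 2) = 1 := by
  ext x
  rw [pow_two, map_mul, Equiv.Perm.mul_apply, actsByNeighbours_permBar i hi hin,
    actsByNeighbours_permBar i hi hin, Equiv.Perm.one_apply]
  split_ifs <;> omega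

theorem permBar_pureGen {i j : ℕ} (hi : 1 ≤ i) (hin : i < n) : permBar n (pureGen n i j) = 1 := by
  rw [pureGen, map_mul, map_mul, permBar_sig_sq hi hin, mul_one, map_inv, mul_inv_cancel]

theorem pureGen_succ_self (i : ℕ) : pureGen n i (i + 1) = sig n i ^ 2 := by
  simp [pureGen, descProd_of_lt]

theorem pureGen_succ {i j : ℕ} (hij : i < j) :
    pureGen n i (j + 1) = sig n j * pureGen n i j * (sig n j)⁻¹ := by
  obtain ⟨k, rfl⟩ : ∃ k, j = k + 1 := ⟨j - 1, by omega⟩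
  simp only [pureGen, Nat.add_sub_cancel]
  rw [descProd_succ_top _ (by omega)]
  group

/-- `σ_i` commutes with the far letters, and conjugation by `σ_i σ_{i+1}` turns `σ_i²` into
`σ_{i+1}²`. -/
theorem conj_sig_pureGen {i j : ℕ} (hi : 1 ≤ i) (hij : i + 1 < j) (hj : j ≤ n) :
    sig n i * pureGen n i j * (sig n i)⁻¹ = pureGen n (i + 1) j := by
  obtain ⟨k, rfl⟩ : ∃ k, j = k + 1 := ⟨j - 1, by omega⟩
  simp only [pureGen, Nat.add_sub_cancel]
  rw [descProd_bot _ (by omega : i + 1 ≤ k)]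
  have hc : Commute (sig n i) (descProd (sig n) (i + 1 + 1) k) :=
    commute_descProd fun l hl hl' => isBraidSeq_sig.commute (by omega) (by omega) (by omega)
      (by omega) (by omega)
  have hb := isBraidSeq_sig (n := n).braid i hi (by omega)
  generalize descProd (sig n) (i + 1 + 1) k = d at *
  generalize sig n i = a at *
  generalize sig n (i + 1) = b at *
  have h1 : a * b * a ^ 2 = b ^ 2 * (a * b) := by
    calc a * b * a ^ 2 = (a * b * a) * a := by simp only [pow_two, mul_assoc]
      _ = (b * a * b) * a := by rw [hb]
      _ = b * (a * b * a) := by simp only [mul_assoc]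
      _ = _ := by rw [← hb]; simp only [pow_two, mul_assoc]
  calc a * (d * b * a ^ 2 * (d * b)⁻¹) * a⁻¹ = (a * d) * b * a ^ 2 * b⁻¹ * (a * d)⁻¹ := by group
    _ = d * (a * b * a ^ 2) * b⁻¹ * (a * d)⁻¹ := by rw [hc.eq]; group
    _ = d * b ^ 2 * d⁻¹ := by rw [h1, hc.eq]; group

theorem commute_sig_pureGen {i j k : ℕ} (hi : 1 ≤ i) (hij : i < j) (hj : j ≤ n) (hk : 1 ≤ k)
    (hkn : k < n) (h : k + 1 < i ∨ j < k ∨ (i < k ∧ k + 1 < j)) :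
    Commute (sig n k) (pureGen n i j) := by
  have hout : ∀ l, 1 ≤ l → l < n → (k + 2 ≤ l ∨ l + 2 ≤ k) → Commute (sig n k) (sig n l) :=
    fun l hl hln h => isBraidSeq_sig.commute hk hl hkn hln h
  unfold pureGen
  rcases h with h | h | ⟨h, h'⟩
  · have hd : Commute (sig n k) (descProd (sig n) (i + 1) (j - 1)) :=
      commute_descProd fun l hl hl' => hout l (by omega) (by omega) (by omega)
    exact (hd.mul_right ((hout i hi (by omega) (by omega)).pow_right 2)).mul_right hd.inv_right
  · have hd : Commute (sig n k) (descProd (sig n) (i + 1) (j - 1)) :=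
      commute_descProd fun l hl hl' => hout l (by omega) (by omega) (by omega)
    exact (hd.mul_right ((hout i hi (by omega) (by omega)).pow_right 2)).mul_right hd.inv_right
  -- For `k` strictly between the ends, `σ_k` is the conjugate by the run of `σ_{k+1}`, which
  -- commutes with `σ_i`.
  · have hd := isBraidSeq_sig (n := n).descProd_mul_gen (a := i + 1) (b := j - 1) (i := k + 1)
      (by omega) (by omega) (by omega) (by omega)
    have hc : Commute (sig n (k + 1)) (sig n i) :=
      isBraidSeq_sig.commute (by omega) hi (by omega) (by omega) (by omega)
    rw [Nat.add_sub_cancel] at hd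
    generalize descProd (sig n) (i + 1) (j - 1) = d at *
    have : sig n k = d * sig n (k + 1) * d⁻¹ := by rw [hd]; group
    rw [this]
    exact (hc.pow_right 2).conj d

variable (n) in
/-- The subgroup generated by the `A_{i,j}`. -/
def pureGenClosure : Subgroup (BraidQuot n) :=
  Subgroup.closure {g | ∃ i j, 1 ≤ i ∧ i < j ∧ j ≤ n ∧ g = pureGen n i j}

theorem pureGen_mem {i j : ℕ} (hi : 1 ≤ i) (hij : i < j) (hj : j ≤ n) :
    pureGen n i j ∈ pureGenClosure n :=
  Subgroup.subset_closure ⟨i, j, hi, hij, hj, rfl⟩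

theorem sig_sq_mem {i : ℕ} (hi : 1 ≤ i) (hin : i < n) : sig n i ^ 2 ∈ pureGenClosure n := by
  rw [← pureGen_succ_self]
  exact pureGen_mem hi (by omega) (by omega)

/-- Each `σ_k` permutes the `A_{i,j}` up to conjugation by `σ_k²`, which is itself one of them. -/
instance pureGenClosure_normal : (pureGenClosure n).Normal := by
  refine normal_of_conj_gens rfl closure_sig ?_ ?_
  · rintro _ ⟨k, hk, hkn, rfl⟩ _ ⟨i, j, hi, hij, hj, rfl⟩
    have hsq := sig_sq_mem hk hkn
    by_cases h : k + 1 < i ∨ j < k ∨ (i < k ∧ k + 1 < j)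
    · rw [(commute_sig_pureGen hi hij hj hk hkn h).eq, mul_inv_cancel_right]
      exact pureGen_mem hi hij hj
    by_cases h1 : k = j
    · subst h1
      rw [← pureGen_succ hij]
      exact pureGen_mem hi (by omega) hkn
    by_cases h2 : k = i
    · subst h2
      by_cases h3 : j = k + 1
      · subst h3
        rw [pureGen_succ_self]
        convert hsq using 1
        group
      · rw [conj_sig_pureGen hi (by omega) hj]
        exact pureGen_mem (by omega) (by omega) hj
    -- In the two remaining cases `A_{i,j}` is already a `σ_k`-conjugate of another generator, so a
    -- second conjugation amounts to one by `σ_k²`.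
    by_cases h3 : k + 1 = j
    · subst h3
      rw [pureGen_succ (by omega)]
      have := mul_mem (mul_mem hsq (pureGen_mem hi (by omega : i < k) (by omega))) (inv_mem hsq)
      convert this using 1
      rw [pow_two]
      group
    · obtain rfl : i = k + 1 := by omega
      rw [← conj_sig_pureGen hk (by omega) hj]
      have := mul_mem (mul_mem hsq (pureGen_mem hk (by omega : k < j) hj)) (inv_mem hsq)
      convert this using 1
      rw [pow_two]
      group
  · rintro _ ⟨k, hk, hkn, rfl⟩
    exact ⟨1, sig_sq_mem hk hkn⟩

theorem pureGenClosure_le_ker : pureGenClosure n ≤ (permBar n).ker := by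
  rw [pureGenClosure, Subgroup.closure_le]
  rintro _ ⟨i, j, hi, hij, hj, rfl⟩
  exact permBar_pureGen hi (by omega)

/-- The `A_{i,j}` generate the image of the pure braid group. -/
theorem mem_pureGenClosure {g : BraidQuot n} (hg : permBar n g = 1) : g ∈ pureGenClosure n := by
  rw [← QuotientGroup.eq_one_iff]
  -- Modulo the `A_{i,j}` the generators become involutions, so the quotient is governed by the
  -- Coxeter presentation, where permutations are faithful.
  let s : ℕ → BraidQuot n ⧸ pureGenClosure n := fun i => QuotientGroup.mk' _ (sig n i)
  let p : BraidQuot n ⧸ pureGenClosure n →* Equiv.Perm (Fin n) :=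
    QuotientGroup.lift _ (permBar n) pureGenClosure_le_ker
  have hs : IsBraidSeq n s :=
    ⟨fun i j hi hij hj => (isBraidSeq_sig.comm i j hi hij hj).map _,
      fun i hi hij => by
        simp only [s, ← map_mul]
        rw [isBraidSeq_sig.braid i hi hij]⟩
  have hsq : ∀ i, 1 ≤ i → i < n → s i * s i = 1 := by
    intro i hi hin
    simp only [s, ← map_mul]
    rw [← pow_two]
    exact (QuotientGroup.eq_one_iff _).2 (sig_sq_mem hi hin)
  refine eq_one_of_perm_eq_one hs hsq (p := p) actsByNeighbours_permBar le_rfl ?_ hg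
  have := Subgroup.mem_map_of_mem (QuotientGroup.mk' (pureGenClosure n))
    (Subgroup.mem_top g)
  rw [← closure_sig, MonoidHom.map_closure] at this
  refine Subgroup.closure_mono ?_ this
  rintro _ ⟨_, ⟨i, hi, hin, rfl⟩, rfl⟩
  exact ⟨i, hi, hin, rfl⟩

end Relations

/-! ### Homomorphisms out of `ℤ^ι` given by commuting families -/

section FreeHom

variable {ι G : Type*} [Group G]

theorem pairwise_commute_zpowersHom {v : ι → G} (hv : ∀ i j, Commute (v i) (v j)) :
    Pairwise fun i j => ∀ x y, Commute (zpowersHom G (v i) x) (zpowersHom G (v j) y) :=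
  fun i j _ x y => (hv i j).zpow_zpow x.toAdd y.toAdd

variable [Fintype ι]

/-- The homomorphism `f ↦ ∏ i, v i ^ f i` of a commuting family `v`. -/
noncomputable def powHom (v : ι → G) (hv : ∀ i j, Commute (v i) (v j)) :
    (ι → Multiplicative ℤ) →* G :=
  MonoidHom.noncommPiCoprod (fun i => zpowersHom G (v i)) (pairwise_commute_zpowersHom hv)

variable {v : ι → G} {hv : ∀ i j, Commute (v i) (v j)}

theorem powHom_mulSingle [DecidableEq ι] (i : ι) (m : Multiplicative ℤ) :
    powHom v hv (Pi.mulSingle i m) = v i ^ m.toAdd := by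
  rw [powHom, MonoidHom.noncommPiCoprod_mulSingle]
  rfl

theorem range_powHom : (powHom v hv).range = Subgroup.closure (Set.range v) := by
  classical
  rw [powHom, MonoidHom.noncommPiCoprod_range]
  apply le_antisymm
  · rw [iSup_le_iff]
    rintro i _ ⟨m, rfl⟩
    exact Subgroup.zpow_mem _ (Subgroup.subset_closure (Set.mem_range_self i)) m.toAdd
  · rw [Subgroup.closure_le]
    rintro _ ⟨i, rfl⟩
    exact Subgroup.mem_iSup_of_mem (S := fun i => (zpowersHom G (v i)).range) i
      (show v i ∈ (zpowersHom G (v i)).range from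
        MonoidHom.mem_range.2 ⟨Multiplicative.ofAdd 1, by simp⟩)

theorem map_powHom {H : Type*} [Group H] (φ : G →* H) {w : ι → H}
    (hw : ∀ i j, Commute (w i) (w j)) (h : ∀ i, φ (v i) = w i) (f : ι → Multiplicative ℤ) :
    φ (powHom v hv f) = powHom w hw f := by
  classical
  refine DFunLike.congr_fun (f := φ.comp (powHom v hv)) (g := powHom w hw) ?_ f
  refine MonoidHom.pi_ext fun i m => ?_
  rw [MonoidHom.comp_apply, powHom_mulSingle, powHom_mulSingle, map_zpow, h]

theorem powHom_mem {N : Subgroup G} {f : ι → Multiplicative ℤ}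
    (h : ∀ i, v i ^ (f i).toAdd ∈ N) : powHom v hv f ∈ N := by
  rw [powHom, MonoidHom.noncommPiCoprod_apply]
  exact Subgroup.noncommProd_mem _ _ fun i _ => h i

end FreeHom

/-! ### The crossed homomorphism that counts crossings -/

section Model

variable {n : ℕ}

/-- Permutations act on unordered pairs. -/
instance sym2Action : MulAction (Equiv.Perm (Fin n)) (Sym2 (Fin n)) where
  smul g s := s.map g
  one_smul s := by
    change s.map id = s
    simp
  mul_smul g h s := by
    change s.map (g ∘ h) = (s.map h).map g
    rw [Sym2.map_map]

theorem smul_mk (g : Equiv.Perm (Fin n)) (x y : Fin n) : g • s(x, y) = s(g x, g y) := rfl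

variable (n) in
/-- The wreath type group in which `B_n / [P_n, P_n]` embeds. -/
abbrev PairModel : Type :=
  (Sym2 (Fin n) → Multiplicative ℤ) ⋊[mulAutArrow] Equiv.Perm (Fin n)

open Classical in
theorem mulAutArrow_mulSingle (g : Equiv.Perm (Fin n)) (s : Sym2 (Fin n)) (m : Multiplicative ℤ) :
    mulAutArrow g (Pi.mulSingle s m : Sym2 (Fin n) → Multiplicative ℤ) =
      Pi.mulSingle (g • s) m := by
  funext u
  change (Pi.mulSingle s m : Sym2 (Fin n) → Multiplicative ℤ) (g⁻¹ • u) = _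
  rw [Pi.mulSingle_apply, Pi.mulSingle_apply]
  simp only [inv_smul_eq_iff]

open Classical in
/-- The image of the standard generators in `PairModel n`. -/
noncomputable def modelGen (n : ℕ) (i : Fin (n - 1)) : PairModel n :=
  ⟨Pi.mulSingle s(⟨(i : ℕ), by omega⟩, ⟨(i : ℕ) + 1, by omega⟩) (Multiplicative.ofAdd 1),
    adjSwap n i⟩

/-- On both sides of a braid relation each of the three pairs of strings crosses exactly once, so
only the order of the summands differs. -/
theorem modelGen_relators (n : ℕ) :
    ∀ w ∈ braidRelators n, FreeGroup.lift (modelGen n) w = 1 := by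
  intro w hw
  have hR := adjSwap_relators n w hw
  rcases hw with ⟨i, j, hij, rfl⟩ | ⟨i, j, hij, rfl⟩
  · rw [map_mul, map_inv, mul_inv_eq_one] at hR ⊢
    simp only [map_mul, FreeGroup.lift_apply_of] at hR ⊢
    refine SemidirectProduct.ext ?_ hR
    simp only [SemidirectProduct.mul_left, modelGen, mulAutArrow_mulSingle, smul_mk, adjSwap]
    rw [Equiv.swap_apply_of_ne_of_ne, Equiv.swap_apply_of_ne_of_ne, Equiv.swap_apply_of_ne_of_ne,
      Equiv.swap_apply_of_ne_of_ne, mul_comm] <;> simp only [ne_eq, Fin.mk.injEq] <;> omega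
  · rw [map_mul, map_inv, mul_inv_eq_one] at hR ⊢
    simp only [map_mul, FreeGroup.lift_apply_of] at hR ⊢
    refine SemidirectProduct.ext ?_ hR
    have hj : ∀ h, (⟨(j : ℕ), h⟩ : Fin n) = ⟨(i : ℕ) + 1, by omega⟩ := fun h => Fin.ext hij
    have hj' : ∀ h, (⟨(j : ℕ) + 1, h⟩ : Fin n) = ⟨(i : ℕ) + 2, by omega⟩ :=
      fun h => Fin.ext (by simp only; omega)
    simp only [SemidirectProduct.mul_left, SemidirectProduct.mul_right, modelGen,
      mulAutArrow_mulSingle, mul_smul, adjSwap, hj, hj']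
    have key : ∀ x y z : Fin n, x ≠ y → x ≠ z → y ≠ z →
        (Pi.mulSingle s(y, z) (Multiplicative.ofAdd 1) : Sym2 (Fin n) → Multiplicative ℤ) *
          Pi.mulSingle (Equiv.swap y z • s(x, y)) (Multiplicative.ofAdd 1) *
          Pi.mulSingle (Equiv.swap y z • Equiv.swap x y • s(y, z)) (Multiplicative.ofAdd 1) =
        Pi.mulSingle s(x, y) (Multiplicative.ofAdd 1) *
          Pi.mulSingle (Equiv.swap x y • s(y, z)) (Multiplicative.ofAdd 1) *
          Pi.mulSingle (Equiv.swap x y • Equiv.swap y z • s(x, y)) (Multiplicative.ofAdd 1) := by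
      intro x y z hxy hxz hyz
      simp only [smul_mk, Equiv.swap_apply_left, Equiv.swap_apply_right,
        Equiv.swap_apply_of_ne_of_ne hxy hxz, Equiv.swap_apply_of_ne_of_ne hxz.symm hyz.symm]
      rw [mul_assoc, mul_comm, mul_comm (Pi.mulSingle s(x, z) _)]
    exact key _ _ _ (by simp) (by simp) (by simp)

/-- The representation of `B_n / [P_n, P_n]` in `PairModel n`. -/
noncomputable def modelHom (n : ℕ) : BraidQuot n →* PairModel n :=
  QuotientGroup.lift _ (PresentedGroup.toGroup (modelGen_relators n)) (by
    have hright : ∀ b, (PresentedGroup.toGroup (modelGen_relators n) b).right = braidPerm n b := by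
      refine DFunLike.congr_fun (f := SemidirectProduct.rightHom.comp
        (PresentedGroup.toGroup (modelGen_relators n))) (g := braidPerm n) ?_
      refine PresentedGroup.ext fun i => ?_
      simp only [MonoidHom.comp_apply, PresentedGroup.toGroup.of, braidPerm]
      rfl
    -- Pure braids map to elements with trivial permutation, which multiply inside the abelian group
    -- of functions; so their commutators die.
    rw [Subgroup.commutator_le]
    intro a ha b hb
    have ha' := hright a
    have hb' := hright b
    rw [show braidPerm n a = 1 from ha] at ha'
    rw [show braidPerm n b = 1 from hb] at hb'
    rw [MonoidHom.mem_ker, commutatorElement_def, map_mul, map_mul, map_mul, map_inv, map_inv,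
      mul_inv_eq_one, mul_inv_eq_iff_eq_mul]
    refine SemidirectProduct.ext ?_ ?_
    · rw [SemidirectProduct.mul_left, SemidirectProduct.mul_left, ha', hb', map_one,
        MulAut.one_apply, MulAut.one_apply, mul_comm]
    · rw [SemidirectProduct.mul_right, SemidirectProduct.mul_right, ha', hb'])

theorem modelHom_right (g : BraidQuot n) : (modelHom n g).right = permBar n g := by
  refine DFunLike.congr_fun (f := SemidirectProduct.rightHom.comp (modelHom n))
    (g := permBar n) ?_ g
  refine QuotientGroup.monoidHom_ext _ (PresentedGroup.ext fun i => ?_)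
  change (PresentedGroup.toGroup (modelGen_relators n) (.of i)).right =
    PresentedGroup.toGroup (adjSwap_relators n) (.of i)
  rw [PresentedGroup.toGroup.of, PresentedGroup.toGroup.of]
  rfl

/-- The action of a permutation on integral functions of pairs. -/
def act (g : Equiv.Perm (Fin n)) : (Sym2 (Fin n) → ℤ) →+ (Sym2 (Fin n) → ℤ) where
  toFun f s := f (g⁻¹ • s)
  map_zero' := rfl
  map_add' _ _ := rfl

open Classical in
/-- The characteristic function of a pair. -/
noncomputable def edge (s : Sym2 (Fin n)) : Sym2 (Fin n) → ℤ := Pi.single s 1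

open Classical in
theorem edge_apply (s u : Sym2 (Fin n)) : edge s u = if u = s then 1 else 0 := Pi.single_apply ..

theorem act_edge (g : Equiv.Perm (Fin n)) (s : Sym2 (Fin n)) :
    act g (edge s) = edge (g • s) := by
  funext u
  change edge s (g⁻¹ • u) = _
  simp only [edge_apply, inv_smul_eq_iff]

theorem act_one (f : Sym2 (Fin n) → ℤ) : act 1 f = f := by
  funext u
  change f (1⁻¹ • u) = f u
  rw [inv_one, one_smul]

theorem act_mul (g h : Equiv.Perm (Fin n)) (f : Sym2 (Fin n) → ℤ) :
    act (g * h) f = act g (act h f) := by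
  funext u
  change f ((g * h)⁻¹ • u) = f (h⁻¹ • g⁻¹ • u)
  rw [mul_inv_rev, mul_smul]

/-- The crossed homomorphism which counts, with signs, the crossings of each pair of strings. -/
noncomputable def crossing (g : BraidQuot n) : Sym2 (Fin n) → ℤ :=
  fun s => ((modelHom n g).left s).toAdd

theorem crossing_one : crossing (1 : BraidQuot n) = 0 := by
  funext s
  rw [crossing, map_one]
  rfl

theorem crossing_mul (g h : BraidQuot n) :
    crossing (g * h) = crossing g + act (permBar n g) (crossing h) := by
  funext s
  rw [crossing, map_mul, SemidirectProduct.mul_left, modelHom_right]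
  rfl

theorem crossing_inv (g : BraidQuot n) :
    crossing g⁻¹ = - act (permBar n g)⁻¹ (crossing g) := by
  have := crossing_mul g⁻¹ g
  rw [inv_mul_cancel, crossing_one, map_inv] at this
  exact eq_neg_of_add_eq_zero_left this.symm

theorem crossing_sig {i : ℕ} (hi : 1 ≤ i) (hin : i < n) :
    crossing (sig n i) = edge s(⟨i - 1, by omega⟩, ⟨i, hin⟩) := by
  classical
  have : modelHom n (sig n i) = modelGen n ⟨i - 1, by omega⟩ := by
    rw [sig_eq hi hin]
    exact PresentedGroup.toGroup.of (modelGen_relators n)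
  funext s
  rw [crossing, this, modelGen, edge_apply]
  simp only [Pi.mulSingle_apply, show i - 1 + 1 = i by omega]
  split_ifs <;> rfl

/-- On the kernel of `permBar`, the crossing function is additive. -/
theorem crossing_mul_of_perm {g : BraidQuot n} (hg : permBar n g = 1) (h : BraidQuot n) :
    crossing (g * h) = crossing g + crossing h := by
  rw [crossing_mul, hg, act_one]

theorem crossing_conj (g : BraidQuot n) {a : BraidQuot n} (ha : permBar n a = 1) :
    crossing (g * a * g⁻¹) = act (permBar n g) (crossing a) := by
  rw [crossing_mul, crossing_mul, crossing_inv, map_mul, ha, mul_one, map_neg, ← act_mul,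
    mul_inv_cancel, act_one]
  abel

theorem permBar_conj (g : BraidQuot n) {a : BraidQuot n} (ha : permBar n a = 1) :
    permBar n (g * a * g⁻¹) = 1 := by
  rw [map_mul, map_mul, ha, mul_one, map_inv, mul_inv_cancel]

theorem crossing_pow_of_perm {a : BraidQuot n} (ha : permBar n a = 1) (k : ℕ) :
    crossing (a ^ k) = k • crossing a := by
  induction k with
  | zero => rw [pow_zero, crossing_one, zero_smul]
  | succ k ih => rw [pow_succ', crossing_mul_of_perm ha, ih, succ_nsmul']

theorem crossing_pow (g : BraidQuot n) (k : ℕ) :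
    crossing (g ^ k) = ∑ i ∈ Finset.range k, act (permBar n g ^ i) (crossing g) := by
  induction k with
  | zero => rw [pow_zero, crossing_one, Finset.range_zero, Finset.sum_empty]
  | succ k ih => rw [pow_succ, crossing_mul, ih, Finset.sum_range_succ, map_pow]

theorem permBar_powHom {ι : Type*} [Fintype ι] {v : ι → BraidQuot n}
    {hc : ∀ i j, Commute (v i) (v j)} (hv : ∀ i, permBar n (v i) = 1) (f : ι → Multiplicative ℤ) :
    permBar n (powHom v hc f) = 1 := by
  have := powHom_mem (v := v) (hv := hc) (N := (permBar n).ker) (f := f)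
    fun i => zpow_mem (hv i) _
  exact this

/-- Both sides are homomorphisms in `f`, because `crossing` is additive on elements with trivial
permutation; it suffices to compare them on one coordinate at a time. -/
theorem crossing_powHom {ι : Type*} [Fintype ι] {v : ι → BraidQuot n}
    {hc : ∀ i j, Commute (v i) (v j)} (hv : ∀ i, permBar n (v i) = 1) (f : ι → Multiplicative ℤ) :
    crossing (powHom v hc f) = ∑ i, (f i).toAdd • crossing (v i) := by
  classical
  let c : (ι → Multiplicative ℤ) →* Multiplicative (Sym2 (Fin n) → ℤ) :=
    { toFun := fun f => Multiplicative.ofAdd (crossing (powHom v hc f))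
      map_one' := by rw [map_one, crossing_one]; rfl
      map_mul' := fun f g => by
        rw [map_mul, crossing_mul_of_perm (permBar_powHom hv f)]; rfl }
  let d : (ι → Multiplicative ℤ) →* Multiplicative (Sym2 (Fin n) → ℤ) :=
    { toFun := fun f => Multiplicative.ofAdd (∑ i, (f i).toAdd • crossing (v i))
      map_one' := by simp
      map_mul' := fun f g => by
        simp only [Pi.mul_apply, toAdd_mul, add_smul, Finset.sum_add_distrib]; rfl }
  have hnat : ∀ i (k : ℕ), crossing (v i ^ k) = k • crossing (v i) :=
    fun i k => crossing_pow_of_perm (hv i) k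
  have : c = d := by
    refine MonoidHom.pi_ext fun i m => ?_
    change Multiplicative.ofAdd _ = Multiplicative.ofAdd _
    congr 1
    rw [powHom_mulSingle, Finset.sum_eq_single i]
    · rw [Pi.mulSingle_eq_same]
      obtain ⟨k, hk | hk⟩ := Int.eq_nat_or_neg m.toAdd
      · rw [hk, zpow_natCast, hnat, natCast_zsmul]
      · have hk1 : permBar n (v i ^ k) = 1 := by rw [map_pow, hv, one_pow]
        rw [hk, zpow_neg, zpow_natCast, crossing_inv, hk1, inv_one, act_one, hnat, neg_smul,
          natCast_zsmul]
    · intro j _ hj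
      rw [Pi.mulSingle_eq_of_ne hj]
      simp
    · simp
  exact DFunLike.congr_fun this f

end Model

/-! ### Crossings of the standard elements, and faithfulness -/

section Crossings

variable {n : ℕ}

open Classical in
/-- The characteristic function of the pair of the strings `a` and `b`, counted from `0`. -/
noncomputable def natEdge (n a b : ℕ) : Sym2 (Fin n) → ℤ :=
  fun s => if s.map Fin.val = s(a, b) then 1 else 0

theorem natEdge_coe (x y : Fin n) : natEdge n x y = edge s(x, y) := by
  funext s
  have : s.map Fin.val = s((x : ℕ), (y : ℕ)) ↔ s = s(x, y) := by
    rw [← Sym2.map_mk, (Sym2.map.injective Fin.val_injective).eq_iff]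
  simp only [natEdge, edge_apply, this]

theorem natEdge_mk {a b : ℕ} (ha : a < n) (hb : b < n) :
    natEdge n a b = edge s(⟨a, ha⟩, ⟨b, hb⟩) := natEdge_coe ⟨a, ha⟩ ⟨b, hb⟩

theorem act_natEdge (g : Equiv.Perm (Fin n)) {a b : ℕ} (ha : a < n) (hb : b < n) :
    act g (natEdge n a b) = natEdge n (g ⟨a, ha⟩) (g ⟨b, hb⟩) := by
  rw [natEdge_mk ha hb, act_edge, smul_mk, natEdge_coe]

theorem crossing_sig' {i : ℕ} (hi : 1 ≤ i) (hin : i < n) :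
    crossing (sig n i) = natEdge n (i - 1) i := by
  rw [crossing_sig hi hin, natEdge_mk]

theorem act_sig {i : ℕ} (hi : 1 ≤ i) (hin : i < n) :
    act (permBar n (sig n i)) (natEdge n (i - 1) i) = natEdge n (i - 1) i := by
  rw [act_natEdge _ (by omega) hin, actsByNeighbours_permBar i hi hin,
    actsByNeighbours_permBar i hi hin, if_pos rfl, if_neg (by simp only; omega), if_pos rfl]
  funext s
  rw [natEdge, natEdge, Sym2.eq_swap]

theorem permBar_inv_sig {i : ℕ} (hi : 1 ≤ i) (hin : i < n) :
    (permBar n (sig n i))⁻¹ = permBar n (sig n i) := by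
  have := permBar_sig_sq hi hin
  rw [pow_two, map_mul] at this
  exact inv_eq_of_mul_eq_one_left this

theorem crossing_inv_sig {i : ℕ} (hi : 1 ≤ i) (hin : i < n) :
    crossing (sig n i)⁻¹ = -natEdge n (i - 1) i := by
  rw [crossing_inv, permBar_inv_sig hi hin, crossing_sig' hi hin, act_sig hi hin]

/-- A descending run moves a single string past all the others: every further letter on the left
carries the pairs `{i - 1, b}` to `{i - 1, b + 1}`. The signs `ε` allow for inverse letters. -/
theorem crossing_descProd {F : ℕ → BraidQuot n} (hF : ActsByNeighbours n (permBar n) F) {ε : ℕ → ℤ}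
    {a b : ℕ} (ha : 1 ≤ a) (hab : a ≤ b + 1) (hb : b < n)
    (hε : ∀ i, a ≤ i → i ≤ b → crossing (F i) = ε i • natEdge n (i - 1) i) :
    crossing (descProd F a b) = ∑ i ∈ Finset.Icc a b, ε i • natEdge n (i - 1) b := by
  have hab' : a - 1 ≤ b := by omega
  induction b, hab' using Nat.le_induction with
  | base => rw [descProd_of_lt F (by omega), crossing_one, Finset.Icc_eq_empty (by omega),
      Finset.sum_empty]
  | succ b hb' ih =>
    rw [descProd_succ_top F (by omega), crossing_mul, hε _ (by omega) le_rfl,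
      ih (by omega) (by omega) fun i hi hi' => hε i hi (by omega), map_sum,
      ← Finset.insert_Icc_right_eq_Icc_add_one (by omega : a ≤ b + 1),
      Finset.sum_insert (by simp)]
    rw [Nat.add_sub_cancel]
    congr 1
    refine Finset.sum_congr rfl fun i hi => ?_
    rw [Finset.mem_Icc] at hi
    rw [map_zsmul, act_natEdge _ (by omega) (by omega), hF _ (by omega) hb, hF _ (by omega) hb]
    simp only
    rw [if_neg (by omega), if_neg (by omega), if_pos (by omega)]

theorem crossing_pureGen {i j : ℕ} (hi : 1 ≤ i) (hij : i < j) (hj : j ≤ n) :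
    crossing (pureGen n i j) = (2 : ℤ) • natEdge n (i - 1) (j - 1) := by
  have hin : i < n := by omega
  rw [pureGen, crossing_conj _ (permBar_sig_sq hi hin), pow_two, crossing_mul,
    crossing_sig' hi hin, act_sig hi hin, ← two_zsmul, map_zsmul,
    act_natEdge _ (by omega) (by omega),
    perm_descProd actsByNeighbours_permBar (by omega) (by omega) (by omega),
    perm_descProd actsByNeighbours_permBar (by omega) (by omega) (by omega)]
  simp only
  rw [if_neg (by omega), if_neg (by omega), if_pos (by omega)]

theorem edge_eq_iff_apply {s u : Sym2 (Fin n)} : edge s u = 1 ↔ u = s := by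
  rw [edge_apply]
  split_ifs with h <;> simp [h]

/-- Elements of `B_n / [P_n, P_n]` are determined by their permutations and crossings. -/
theorem eq_one_of_crossing_eq_zero {g : BraidQuot n} (hg : permBar n g = 1)
    (hg' : crossing g = 0) : g = 1 := by
  let v : {p : Fin n × Fin n // p.1 < p.2} → BraidQuot n :=
    fun p => pureGen n (p.1.1 + 1) (p.1.2 + 1)
  have hv1 : ∀ p, permBar n (v p) = 1 := fun p =>
    permBar_pureGen (by omega) (by have := p.2; omega)
  have hv2 : ∀ p, crossing (v p) = (2 : ℤ) • edge s(p.1.1, p.1.2) := fun p => by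
    rw [crossing_pureGen (by omega) (by have := p.2; omega) (by omega), ← natEdge_coe]
    rfl
  have hc : ∀ i j, Commute (v i) (v j) := fun i j => commute_of_permBar_eq_one (hv1 i) (hv1 j)
  have hmem : g ∈ (powHom v hc).range := by
    rw [range_powHom]
    refine Subgroup.closure_mono ?_ (mem_pureGenClosure hg)
    rintro _ ⟨i, j, hi, hij, hj, rfl⟩
    refine ⟨⟨(⟨i - 1, by omega⟩, ⟨j - 1, by omega⟩), by simp only [Fin.mk_lt_mk]; omega⟩, ?_⟩
    simp only [v]
    rw [Nat.sub_add_cancel hi, Nat.sub_add_cancel (by omega)]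
  obtain ⟨f, rfl⟩ := hmem
  rw [crossing_powHom hv1] at hg'
  suffices f = 1 by rw [this, map_one]
  funext p
  -- Different `p` give different unordered pairs, so evaluation at this pair isolates twice the
  -- exponent `f p`.
  have := congrFun hg' s(p.1.1, p.1.2)
  rw [Finset.sum_apply, Finset.sum_eq_single p] at this
  · rw [hv2, Pi.smul_apply, Pi.smul_apply, edge_eq_iff_apply.2 rfl] at this
    have h0 : (f p).toAdd = 0 := by simpa using this
    exact h0
  · intro p' _ hp'
    rw [hv2, Pi.smul_apply, Pi.smul_apply, edge_apply, if_neg]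
    · simp
    · intro h
      apply hp'
      rw [Sym2.eq_iff] at h
      rcases h with ⟨h1, h2⟩ | ⟨h1, h2⟩
      · exact Subtype.ext (Prod.ext h1.symm h2.symm)
      · have h3 := p.2
        rw [h1, h2] at h3
        exact absurd h3 p'.2.asymm
  · simp

/-- The tool for every later identity in `B_n / [P_n, P_n]`: it becomes one between permutations and
one between integral functions. -/
theorem eq_of_crossing_eq {g h : BraidQuot n} (h1 : permBar n g = permBar n h)
    (h2 : crossing g = crossing h) : g = h := by
  rw [← mul_inv_eq_one]
  apply eq_one_of_crossing_eq_zero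
  · rw [map_mul, map_inv, h1, mul_inv_cancel]
  · rw [crossing_mul, crossing_inv, map_neg, ← act_mul, h1, mul_inv_cancel, act_one, h2,
      add_neg_cancel]

end Crossings

/-! ### Cyclic coordinates on the blocks -/

section Points

variable {t : ℕ} {P : Fin t → ℕ}

theorem offset_add_le_offset {i j : Fin t} (h : i < j) : offset P i + P i ≤ offset P j := by
  unfold offset
  rw [add_comm, ← Finset.sum_insert (by simp)]
  refine Finset.sum_le_sum_of_subset ?_
  intro k hk
  simp only [Finset.mem_insert, Finset.mem_Iio] at hk ⊢
  rcases hk with rfl | hk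
  · exact h
  · exact hk.trans h

theorem offset_add_le_strands (j : Fin t) : offset P j + P j ≤ strands P := by
  unfold offset strands
  rw [add_comm, ← Finset.sum_insert (by simp)]
  exact Finset.sum_le_sum_of_subset (Finset.subset_univ _)

variable [hP : ∀ j, NeZero (P j)]

/-- The strings of block `j`, parametrized by the residues modulo `P j`. -/
def pt (j : Fin t) (x : ZMod (P j)) : Fin (strands P) :=
  ⟨offset P j + x.val, by have := offset_add_le_strands (P := P) j; have := x.val_lt; omega⟩

theorem val_pt (j : Fin t) (x : ZMod (P j)) : (pt j x : ℕ) = offset P j + x.val := rfl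

theorem val_pt_natCast (j : Fin t) {u : ℕ} (hu : u < P j) :
    (pt j (u : ZMod (P j)) : ℕ) = offset P j + u := by
  rw [val_pt, ZMod.val_natCast_of_lt hu]

theorem pt_bijective : Function.Bijective fun s : Σ j, ZMod (P j) => pt s.1 s.2 := by
  rw [Fintype.bijective_iff_injective_and_card]
  constructor
  · rintro ⟨i, x⟩ ⟨j, y⟩ h
    have h' : offset P i + x.val = offset P j + y.val := congrArg Fin.val h
    have := x.val_lt
    have := y.val_lt
    rcases lt_trichotomy i j with hij | rfl | hij
    · have := offset_add_le_offset (P := P) hij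
      omega
    · congr 1
      exact ZMod.val_injective _ (by omega)
    · have := offset_add_le_offset (P := P) hij
      omega
  · rw [Fintype.card_sigma, Fintype.card_fin, strands]
    simp only [ZMod.card]

theorem pt_injective (j : Fin t) : Function.Injective (pt (P := P) j) := fun x y h => by
  have := pt_bijective.1 (a₁ := ⟨j, x⟩) (a₂ := ⟨j, y⟩) h
  simpa using this

theorem pt_ne {i j : Fin t} (hij : i ≠ j) (x : ZMod (P i)) (y : ZMod (P j)) :
    pt i x ≠ pt j y := fun h =>
  hij (congrArg Sigma.fst (pt_bijective.1 (a₁ := ⟨i, x⟩) (a₂ := ⟨j, y⟩) h))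

theorem exists_pt (x : Fin (strands P)) : ∃ j y, pt (P := P) j y = x := by
  obtain ⟨⟨j, y⟩, h⟩ := pt_bijective.2 x
  exact ⟨j, y, h⟩

variable (P) in
/-- The strings, sorted by blocks. -/
noncomputable def ptEquiv : (Σ j, ZMod (P j)) ≃ Fin (strands P) :=
  Equiv.ofBijective _ pt_bijective

variable (P) in
/-- The permutation which rotates block `j` by `-f j`. -/
noncomputable def shift : (Fin t → Multiplicative ℤ) →* Equiv.Perm (Fin (strands P)) where
  toFun f := (ptEquiv P).permCongr
    (Equiv.sigmaCongrRight fun j => Equiv.subRight (((f j).toAdd : ℤ) : ZMod (P j)))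
  map_one' := by
    ext x
    obtain ⟨s, rfl⟩ := (ptEquiv P).surjective x
    simp
  map_mul' f g := by
    ext x
    obtain ⟨s, rfl⟩ := (ptEquiv P).surjective x
    simp [Equiv.permCongr_apply, sub_sub, add_comm]

theorem shift_pt (f : Fin t → Multiplicative ℤ) (j : Fin t) (x : ZMod (P j)) :
    shift P f (pt j x) = pt j (x - (((f j).toAdd : ℤ) : ZMod (P j))) := by
  rw [show pt j x = ptEquiv P ⟨j, x⟩ from rfl]
  simp only [shift, MonoidHom.coe_mk, OneHom.coe_mk, Equiv.permCongr_apply,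
    Equiv.symm_apply_apply]
  rfl

end Points

/-! ### Permutations and crossings of `δ` and `x_j` -/

section Blocks

variable {t : ℕ} {P : Fin t → ℕ}

/-- The block sizes are odd, at least `3`, and pairwise coprime. -/
structure Admissible (P : Fin t → ℕ) : Prop where
  odd : ∀ j, Odd (P j)
  three_le : ∀ j, 3 ≤ P j
  coprime : Pairwise (Function.onFun Nat.Coprime P)

/-- The basis vector of block `j`. -/
def unit (j : Fin t) : Fin t → Multiplicative ℤ := Pi.mulSingle j (Multiplicative.ofAdd 1)

theorem toAdd_unit_self (j : Fin t) : (unit j j).toAdd = 1 := by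
  rw [unit, Pi.mulSingle_eq_same, toAdd_ofAdd]

theorem toAdd_unit_of_ne {i j : Fin t} (h : i ≠ j) : (unit j i).toAdd = 0 := by
  rw [unit, Pi.mulSingle_eq_of_ne h, toAdd_one]

/-- The letters of `deltaBlock`. -/
def deltaLetter (n m z i : ℕ) : BraidQuot n :=
  if m + (z + 1) / 2 ≤ i then sig n i else (sig n i)⁻¹

theorem deltaBlock_eq_descProd {n m z : ℕ} (hz : Odd z) (hz' : 3 ≤ z) :
    deltaBlock n m z = descProd (deltaLetter n m z) (m + 1) (m + z - 1) := by
  obtain ⟨k, rfl⟩ := hz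
  rw [deltaBlock, show m + (2 * k + 1 + 1) / 2 = m + (2 * k + 1 - 1) / 2 + 1 by omega,
    ← descProd_mul (deltaLetter n m (2 * k + 1)) (by omega : m + 1 ≤ m + (2 * k + 1 - 1) / 2 + 1)
      (by omega)]
  congr 1
  · exact descProd_congr fun i hi hi' => (if_pos (by omega)).symm
  · exact descProd_congr fun i hi hi' => (if_neg (by omega)).symm

theorem actsByNeighbours_deltaLetter (n m z : ℕ) :
    ActsByNeighbours n (permBar n) (deltaLetter n m z) := by
  intro i hi hin x
  have : permBar n (deltaLetter n m z i) = permBar n (sig n i) := by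
    rw [deltaLetter]
    split_ifs
    · rfl
    · rw [map_inv, permBar_inv_sig hi hin]
  rw [this, actsByNeighbours_permBar i hi hin]

theorem permBar_deltaConj (s : ℕ) {g : BraidQuot (strands P)}
    (hg : permBar (strands P) g = 1) : permBar (strands P) (deltaConj P s g) = 1 :=
  permBar_conj _ (by rw [map_pow, hg, one_pow])

variable [hP : ∀ j, NeZero (P j)]

theorem permBar_delta (hA : Admissible P) (j : Fin t) :
    permBar (strands P) (delta P j) = shift P (unit j) := by
  have h3 := hA.three_le j
  have hle := offset_add_le_strands (P := P) j
  ext x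
  obtain ⟨i, y, rfl⟩ := exists_pt x
  rw [delta, deltaBlock_eq_descProd (hA.odd j) h3,
    perm_descProd (actsByNeighbours_deltaLetter _ _ _) (by omega) (by omega) (by omega), shift_pt]
  have hy := y.val_lt
  by_cases hij : i = j
  · subst hij
    rw [toAdd_unit_self, Int.cast_one, val_pt]
    rcases Nat.eq_zero_or_pos y.val with h0 | h0
    · have : y - 1 = ((P i - 1 : ℕ) : ZMod (P i)) := by
        rw [(ZMod.val_eq_zero y).1 h0, Nat.cast_sub (by omega), ZMod.natCast_self, Nat.cast_one]
      rw [this, val_pt_natCast i (by omega), if_pos (by omega)]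
      omega
    · have : y - 1 = ((y.val - 1 : ℕ) : ZMod (P i)) := by
        rw [Nat.cast_sub h0, ZMod.natCast_zmod_val, Nat.cast_one]
      rw [this, val_pt_natCast i (by omega), if_neg (by omega), if_pos (by omega)]
      omega
  · rw [toAdd_unit_of_ne hij, Int.cast_zero, sub_zero, val_pt]
    rcases lt_or_gt_of_ne hij with h | h
    · have := offset_add_le_offset (P := P) h
      rw [if_neg (by omega), if_neg (by omega)]
    · have := offset_add_le_offset (P := P) h
      rw [if_neg (by omega), if_neg (by omega)]

theorem permBar_rotElt (hA : Admissible P) (j : Fin t) :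
    permBar (strands P) (rotElt P j) = shift P (unit j) := by
  have := offset_add_le_strands (P := P) j
  have := hA.three_le j
  rw [rotElt, map_mul, permBar_pureGen (by omega) (by omega), one_mul, permBar_delta hA]

theorem prod_unit : (List.ofFn (unit (t := t))).prod = fun _ => Multiplicative.ofAdd 1 := by
  rw [List.prod_ofFn]
  exact Finset.univ_prod_mulSingle fun _ => Multiplicative.ofAdd 1

theorem permBar_deltaTotal (hA : Admissible P) :
    permBar (strands P) (deltaTotal P) = shift P fun _ => Multiplicative.ofAdd 1 := by
  rw [deltaTotal, map_list_prod, List.map_ofFn, ← prod_unit, map_list_prod, List.map_ofFn]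
  congr 2
  funext j
  exact permBar_delta hA j

theorem shift_smul (f : Fin t → Multiplicative ℤ) (i j : Fin t) (x : ZMod (P i)) (y : ZMod (P j)) :
    shift P f • s(pt i x, pt j y) =
      s(pt i (x - (((f i).toAdd : ℤ) : ZMod (P i))), pt j (y - (((f j).toAdd : ℤ) : ZMod (P j)))) := by
  rw [smul_mk, shift_pt, shift_pt]

theorem crossing_pureGen_pt {a b : Fin t} {u v i j : ℕ} (hu : u < P a) (hv : v < P b)
    (hi : i = offset P a + u + 1) (hj : j = offset P b + v + 1) (hij : i < j) :
    crossing (pureGen (strands P) i j) =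
      (2 : ℤ) • edge s(pt a (u : ZMod (P a)), pt b (v : ZMod (P b))) := by
  have := offset_add_le_strands (P := P) b
  rw [crossing_pureGen (by omega) hij (by omega), ← natEdge_coe, val_pt_natCast a hu,
    val_pt_natCast b hv]
  subst hi hj
  rfl

theorem sum_range_natCast {M : Type*} [AddCommMonoid M] (N : ℕ) [NeZero N] (f : ZMod N → M) :
    ∑ i ∈ Finset.range N, f (i : ZMod N) = ∑ x, f x := by
  refine Finset.sum_bij' (fun i _ => (i : ZMod N)) (fun x _ => x.val) ?_ ?_ ?_ ?_ ?_
  · simp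
  · intro x _
    simpa using x.val_lt
  · intro i hi
    exact ZMod.val_natCast_of_lt (by simpa using hi)
  · intro x _
    exact ZMod.natCast_zmod_val x
  · simp

/-- The sum of the pairs of strings of block `j` at distance `d`. -/
noncomputable def orbitSum (j : Fin t) (d : ZMod (P j)) : Sym2 (Fin (strands P)) → ℤ :=
  ∑ x : ZMod (P j), edge s(pt j x, pt j (x + d))

/-- Pairs are unordered, so reading each one from its other end reverses the distance. -/
theorem orbitSum_neg (j : Fin t) (d : ZMod (P j)) : orbitSum j (-d) = orbitSum j d := by
  unfold orbitSum
  refine (Fintype.sum_equiv (Equiv.addRight d) _ _ fun x => ?_).symm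
  rw [Equiv.coe_addRight, add_neg_cancel_right, Sym2.eq_swap]

theorem sum_act_shift (j : Fin t) (a b : ZMod (P j)) :
    ∑ i ∈ Finset.range (P j), act (shift P (unit j) ^ i) (edge s(pt j a, pt j b)) =
      orbitSum j (b - a) := by
  have : ∀ i ∈ Finset.range (P j), act (shift P (unit j) ^ i) (edge s(pt j a, pt j b)) =
      edge s(pt j (a - (i : ZMod (P j))), pt j (a - (i : ZMod (P j)) + (b - a))) := by
    intro i _
    rw [← map_pow, act_edge, shift_smul, Pi.pow_apply, toAdd_pow, toAdd_unit_self]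
    congr 4 <;> simp
  rw [Finset.sum_congr rfl this, sum_range_natCast (P j) fun x =>
    edge s(pt j (a - x), pt j (a - x + (b - a)))]
  exact Fintype.sum_equiv (Equiv.subLeft a) _ _ fun x => rfl

theorem crossing_delta (hA : Admissible P) (j : Fin t) :
    crossing (delta P j) = ∑ u ∈ Finset.range (P j - 1),
      (if (P j - 1) / 2 ≤ u then (1 : ℤ) else -1) •
        edge s(pt j (u : ZMod (P j)), pt j ((P j - 1 : ℕ) : ZMod (P j))) := by
  have h3 := hA.three_le j
  have hle := offset_add_le_strands (P := P) j
  rw [delta, deltaBlock_eq_descProd (hA.odd j) h3,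
    crossing_descProd (actsByNeighbours_deltaLetter _ _ _)
      (ε := fun i => if offset P j + (P j + 1) / 2 ≤ i then 1 else -1)
      (by omega) (by omega) (by omega)]
  · symm
    refine Finset.sum_bij' (fun u _ => offset P j + u + 1) (fun i _ => i - offset P j - 1)
      ?_ ?_ ?_ ?_ ?_
    · intro u hu
      simp only [Finset.mem_range, Finset.mem_Icc] at hu ⊢
      omega
    · intro u hu
      simp only [Finset.mem_range, Finset.mem_Icc] at hu ⊢
      omega
    · intro u hu
      omega
    · intro u hu
      simp only [Finset.mem_Icc] at hu ⊢
      omega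
    · intro u hu
      rw [Finset.mem_range] at hu
      have hodd := hA.odd j
      rw [← natEdge_coe, val_pt_natCast j (by omega), val_pt_natCast j (by omega)]
      congr 2
      · obtain ⟨k, hk⟩ := hodd
        exact propext ⟨fun _ => by omega, fun _ => by omega⟩
      · omega
  · intro i hi hi'
    rw [deltaLetter]
    split_ifs
    · rw [crossing_sig' (by omega) (by omega), one_smul]
    · rw [crossing_inv_sig (by omega) (by omega), neg_one_zsmul]

/-- The signs in `δ` are chosen such that its crossings cancel along the rotation. -/
theorem sum_act_crossing_delta (hA : Admissible P) (j : Fin t) :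
    ∑ i ∈ Finset.range (P j), act (shift P (unit j) ^ i) (crossing (delta P j)) = 0 := by
  have h3 := hA.three_le j
  have h1 : ∑ i ∈ Finset.range (P j), act (shift P (unit j) ^ i) (crossing (delta P j)) =
      ∑ u ∈ Finset.range (P j - 1), (if (P j - 1) / 2 ≤ u then (1 : ℤ) else -1) •
        orbitSum j ((u + 1 : ℕ) : ZMod (P j)) := by
    rw [crossing_delta hA]
    simp only [map_sum, map_zsmul]
    rw [Finset.sum_comm]
    refine Finset.sum_congr rfl fun u _ => ?_
    rw [← Finset.smul_sum, sum_act_shift, ← orbitSum_neg]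
    congr 2
    rw [Nat.cast_sub (by omega), ZMod.natCast_self]
    push_cast
    ring
  rw [h1]
  set S := ∑ u ∈ Finset.range (P j - 1), (if (P j - 1) / 2 ≤ u then (1 : ℤ) else -1) •
        orbitSum j ((u + 1 : ℕ) : ZMod (P j)) with hS
  -- The reflection `u ↦ P_j - 2 - u` replaces the distance `u + 1` by its negative, hence keeps the
  -- orbit sum, and exchanges the letters of sign `1` with those of sign `-1`.
  have h2 : S = -S := by
    conv_lhs => rw [hS, ← Finset.sum_range_reflect]
    rw [hS, ← Finset.sum_neg_distrib]
    refine Finset.sum_congr rfl fun u hu => ?_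
    rw [Finset.mem_range] at hu
    have hodd := hA.odd j
    rw [← orbitSum_neg, ← neg_smul]
    congr 1
    · obtain ⟨k, hk⟩ := hodd
      split_ifs <;> first | rfl | (exfalso; omega)
    · congr 1
      rw [neg_eq_iff_add_eq_zero, ← Nat.cast_add,
        show P j - 1 - 1 - u + 1 + (u + 1) = P j by omega, ZMod.natCast_self]
  exact self_eq_neg.1 h2

theorem crossing_rotElt (hA : Admissible P) (j : Fin t) :
    crossing (rotElt P j) = (2 : ℤ) • edge s(pt j 0, pt j 1) + crossing (delta P j) := by
  have := offset_add_le_strands (P := P) j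
  have := hA.three_le j
  rw [rotElt, crossing_mul_of_perm (permBar_pureGen (by omega) (by omega)),
    crossing_pureGen_pt (a := j) (b := j) (u := 0) (v := 1) (by omega) (by omega) (by omega)
      (by omega) (by omega), Nat.cast_zero, Nat.cast_one]

theorem shift_unit_pow_self (j : Fin t) : shift P (unit j) ^ P j = 1 := by
  rw [← map_pow]
  ext x
  obtain ⟨i, y, rfl⟩ := exists_pt x
  rw [shift_pt, Pi.pow_apply, toAdd_pow]
  by_cases h : i = j
  · subst h
    simp [toAdd_unit_self]
  · simp [toAdd_unit_of_ne h]

theorem permBar_rotElt_pow (hA : Admissible P) (j : Fin t) :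
    permBar (strands P) (rotElt P j ^ P j) = 1 := by
  rw [map_pow, permBar_rotElt hA, shift_unit_pow_self]

/-- The contribution of `δ` cancels over the full rotation; what remains is the crossing of
`A_{m+1,m+2}`, where `m` is the offset of the block, carried once to each adjacent pair. -/
theorem crossing_rotElt_pow (hA : Admissible P) (j : Fin t) :
    crossing (rotElt P j ^ P j) = (2 : ℤ) • orbitSum j 1 := by
  rw [crossing_pow, permBar_rotElt hA, crossing_rotElt hA]
  simp only [map_add, map_zsmul]
  rw [Finset.sum_add_distrib, sum_act_crossing_delta hA, add_zero, ← Finset.smul_sum,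
    sum_act_shift, sub_zero]

theorem crossing_deltaConj (hA : Admissible P) (s : ℕ) {g : BraidQuot (strands P)}
    (hg : permBar (strands P) g = 1) {i j : Fin t} {x : ZMod (P i)} {y : ZMod (P j)}
    (hc : crossing g = (2 : ℤ) • edge s(pt i x, pt j y)) :
    crossing (deltaConj P s g) = (2 * order P : ℤ) •
      edge s(pt i (x - (s : ZMod (P i))), pt j (y - (s : ZMod (P j)))) := by
  rw [deltaConj, crossing_conj _ (by rw [map_pow, hg, one_pow]), crossing_pow_of_perm hg, hc,
    map_pow, permBar_deltaTotal hA, ← map_pow, map_nsmul, map_zsmul, act_edge, shift_smul,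
    ← natCast_zsmul, smul_smul, mul_comm]
  simp

end Blocks

/-- The divisor `M` serves the cross families: their index lives modulo `P_a P_b` but is read modulo
`P_a` and modulo `P_b`. -/
theorem natCast_finRotate {N M : ℕ} (hM : M ∣ N) (k : Fin N) :
    (((finRotate N k : Fin N) : ℕ) : ZMod M) = (k : ℕ) + 1 := by
  cases N with
  | zero => exact k.elim0
  | succ N =>
    rw [finRotate_apply, Fin.val_add]
    have : ((k : ℕ) + ((1 : Fin (N + 1)) : ℕ)) % (N + 1) ≡ (k : ℕ) + 1 [MOD N + 1] := by
      rw [Nat.ModEq, Nat.mod_mod, Fin.val_one', Nat.add_mod_mod]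
    have := (ZMod.natCast_eq_natCast_iff _ _ _).2 (this.of_dvd hM)
    rw [this]
    push_cast
    rfl

theorem val_finRotate {N : ℕ} {k : Fin N} (hk : (k : ℕ) + 1 < N) :
    ((finRotate N k : Fin N) : ℕ) = k + 1 := by
  cases N with
  | zero => exact k.elim0
  | succ N => exact coe_finRotate_of_ne_last (Fin.ne_of_lt (Nat.lt_of_succ_lt_succ hk))

/-! ### Lattice generators and pairs of strings -/

section Lattice

variable {t : ℕ} {P : Fin t → ℕ}

/-- The position of the first pair of the orbit `h` of a block. -/
def innerBase (h : ℕ) : ℕ := if h = 0 then 2 else 0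

/-- The indices of the elements `x_j ^ P_j`. -/
def LatticeIndex.IsPower : LatticeIndex P → Prop
  | .inner _ h k => (h : ℕ) = 0 ∧ (k : ℕ) = 0
  | .cross _ _ _ _ => False

theorem latticeElt_power_eq {j : Fin t} {h : Fin ((P j - 1) / 2)} {k : Fin (P j)} (hh : (h : ℕ) = 0)
    (hk : (k : ℕ) = 0) : latticeElt P (.inner j h k) = rotElt P j ^ P j := by
  simp only [latticeElt]
  rw [if_pos hh, if_pos hk]

theorem order_pos (hA : Admissible P) : 0 < order P :=
  Finset.prod_pos fun j _ => by have := hA.three_le j; omega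

variable [hP : ∀ j, NeZero (P j)]

/-- The pair of strings of a lattice generator. -/
def pairOf : LatticeIndex P → Sym2 (Fin (strands P))
  | .inner j h k =>
      s(pt j (((innerBase h : ℕ) : ZMod (P j)) - ((k : ℕ) : ZMod (P j))),
        pt j (((innerBase h : ℕ) : ZMod (P j)) - ((k : ℕ) : ZMod (P j)) +
          (((h : ℕ) + 1 : ℕ) : ZMod (P j))))
  | .cross a b _ k => s(pt a (-((k : ℕ) : ZMod (P a))), pt b (-((k : ℕ) : ZMod (P b))))

theorem natCast_injOn {N u v : ℕ} (hu : u < N) (hv : v < N) (h : (u : ZMod N) = (v : ZMod N)) :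
    u = v := by
  rw [ZMod.natCast_eq_natCast_iff] at h
  exact Nat.ModEq.eq_of_lt_of_lt h hu hv

theorem pt_block_eq {i j : Fin t} {x : ZMod (P i)} {y : ZMod (P j)} (h : pt i x = pt j y) :
    i = j := by
  by_contra hij
  exact pt_ne hij x y h

/-- The blocks and the cyclic distance recover the family of a pair; the position in the orbit
recovers `k`, by coprimality in the cross case. -/
theorem pairOf_injective (hA : Admissible P) : Function.Injective (pairOf (P := P)) := by
  rintro (⟨j, h, k⟩ | ⟨a, b, hab, k⟩) (⟨j', h', k'⟩ | ⟨a', b', hab', k'⟩) heq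
  · have hj : j = j' := by
      rcases Sym2.eq_iff.1 heq with h | h
      · exact pt_block_eq h.1
      · exact pt_block_eq h.1
    subst hj
    have h3 := hA.three_le j
    have hh := h.2
    have hh' := h'.2
    have hhh : (h : ℕ) = h' ∧ ((k : ℕ) : ZMod (P j)) = ((k' : ℕ) : ZMod (P j)) := by
      rcases Sym2.eq_iff.1 heq with ⟨h1, h2⟩ | ⟨h1, h2⟩
      · have h1 := pt_injective j h1
        have h2 := pt_injective j h2
        rw [h1, add_right_inj] at h2
        have := natCast_injOn (by omega) (by omega) h2
        have hheq : (h : ℕ) = h' := by omega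
        rw [hheq, sub_right_inj] at h1
        exact ⟨hheq, h1⟩
      · have h1 := pt_injective j h1
        have h2 := pt_injective j h2
        -- Matching the ends crosswise would make the two distances add up to `0` modulo `P_j`, but
        -- each lies between `1` and `(P_j - 1)/2`.
        rw [h1, add_assoc, add_eq_left, ← Nat.cast_add, ← Nat.cast_zero] at h2
        have := natCast_injOn (by omega) (by omega) h2
        omega
    have hk := natCast_injOn k.2 k'.2 hhh.2
    rw [Fin.ext hhh.1, Fin.ext hk]
  · exfalso
    rcases Sym2.eq_iff.1 heq with h | h
    · exact hab'.ne ((pt_block_eq h.1).symm.trans (pt_block_eq h.2))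
    · exact hab'.ne ((pt_block_eq h.2).symm.trans (pt_block_eq h.1))
  · exfalso
    rcases Sym2.eq_iff.1 heq with h | h
    · exact hab.ne ((pt_block_eq h.1).trans (pt_block_eq h.2).symm)
    · exact hab.ne ((pt_block_eq h.1).trans (pt_block_eq h.2).symm)
  · rcases Sym2.eq_iff.1 heq with h | h
    · obtain rfl := pt_block_eq h.1
      obtain rfl := pt_block_eq h.2
      have h1 := pt_injective a h.1
      have h2 := pt_injective b h.2
      rw [neg_inj, ZMod.natCast_eq_natCast_iff] at h1 h2
      have := (Nat.modEq_and_modEq_iff_modEq_mul (hA.coprime hab.ne)).1 ⟨h1, h2⟩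
      rw [Fin.ext (Nat.ModEq.eq_of_lt_of_lt this k.2 k'.2)]
    · obtain rfl := pt_block_eq h.1
      obtain rfl := pt_block_eq h.2
      exact absurd hab hab'.asymm

theorem pairOf_not_isDiag (hA : Admissible P) (i : LatticeIndex P) : ¬ (pairOf i).IsDiag := by
  rcases i with ⟨j, h, k⟩ | ⟨a, b, hab, k⟩
  · intro hd
    have h1 := pt_injective j (Sym2.mk_isDiag_iff.1 hd)
    rw [left_eq_add, ← Nat.cast_zero] at h1
    have h3 := hA.three_le j
    have hh := h.2
    have := natCast_injOn (by omega) (by omega) h1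
    omega
  · exact fun hd => pt_ne hab.ne _ _ (Sym2.mk_isDiag_iff.1 hd)

theorem exists_inner (j : Fin t) (x d : ZMod (P j)) (h0 : 1 ≤ d.val)
    (h1 : d.val ≤ (P j - 1) / 2) : ∃ i : LatticeIndex P, pairOf i = s(pt j x, pt j (x + d)) := by
  let h : Fin ((P j - 1) / 2) := ⟨d.val - 1, by omega⟩
  let y : ZMod (P j) := ((innerBase h : ℕ) : ZMod (P j)) - x
  refine ⟨.inner j h ⟨y.val, y.val_lt⟩, ?_⟩
  simp only [pairOf]
  rw [ZMod.natCast_zmod_val, sub_sub_cancel, show (h : ℕ) + 1 = d.val from Nat.sub_add_cancel h0,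
    ZMod.natCast_zmod_val]

theorem exists_pairOf (hA : Admissible P) (s : Sym2 (Fin (strands P))) (hs : ¬ s.IsDiag) :
    ∃ i, pairOf i = s := by
  have hcross : ∀ {a b : Fin t}, a < b → ∀ (x : ZMod (P a)) (y : ZMod (P b)),
      ∃ i, pairOf i = s(pt a x, pt b y) := by
    intro a b hab x y
    have hco := hA.coprime hab.ne
    obtain ⟨k, hk1, hk2⟩ := Nat.chineseRemainder hco (-x).val (-y).val
    have hlt : k % (P a * P b) < P a * P b := Nat.mod_lt _
      (Nat.mul_pos (NeZero.pos (P a)) (NeZero.pos (P b)))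
    refine ⟨.cross a b hab ⟨_, hlt⟩, ?_⟩
    have e1 : ((k % (P a * P b) : ℕ) : ZMod (P a)) = -x := by
      rw [← ZMod.natCast_zmod_val (-x), ZMod.natCast_eq_natCast_iff]
      exact ((Nat.mod_modEq _ _).of_dvd (dvd_mul_right _ _)).trans hk1
    have e2 : ((k % (P a * P b) : ℕ) : ZMod (P b)) = -y := by
      rw [← ZMod.natCast_zmod_val (-y), ZMod.natCast_eq_natCast_iff]
      exact ((Nat.mod_modEq _ _).of_dvd (dvd_mul_left _ _)).trans hk2
    simp only [pairOf]
    rw [e1, e2, neg_neg, neg_neg]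
  induction s with
  | _ u v =>
    obtain ⟨i, x, rfl⟩ := exists_pt u
    obtain ⟨j, y, rfl⟩ := exists_pt v
    rcases lt_trichotomy i j with hij | rfl | hij
    · exact hcross hij x y
    · have hne : y - x ≠ 0 := by
        intro h
        rw [sub_eq_zero] at h
        exact hs (by rw [h]; exact Sym2.mk_isDiag_iff.2 rfl)
      have hpos : (y - x).val ≠ 0 := fun h => hne ((ZMod.val_eq_zero _).1 h)
      have hlt := (y - x).val_lt
      by_cases hle : (y - x).val ≤ (P i - 1) / 2
      · have := exists_inner i x (y - x) (by omega) hle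
        rwa [add_sub_cancel] at this
      -- The distance read from the other end is `P_i` minus this one, hence short since `P_i` is
      -- odd.
      · have : NeZero (y - x) := ⟨hne⟩
        have hneg : (x - y).val = P i - (y - x).val := by
          rw [← neg_sub, ZMod.val_neg_of_ne_zero]
        obtain ⟨k, hk⟩ := hA.odd i
        have := exists_inner i y (x - y) (by omega) (by omega)
        rw [add_sub_cancel] at this
        rwa [Sym2.eq_swap]
    · rw [Sym2.eq_swap]
      exact hcross hij y x

theorem permBar_latticeElt (hA : Admissible P) (i : LatticeIndex P) :
    permBar (strands P) (latticeElt P i) = 1 := by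
  rcases i with ⟨j, h, k⟩ | ⟨a, b, hab, k⟩
  · have := offset_add_le_strands (P := P) j
    have := hA.three_le j
    simp only [latticeElt]
    split_ifs
    · exact permBar_rotElt_pow hA j
    · exact permBar_deltaConj _ (permBar_pureGen (by omega) (by omega))
    · exact permBar_deltaConj _ (permBar_pureGen (by omega) (by omega))
  · have := offset_add_le_strands (P := P) a
    have := hA.three_le a
    exact permBar_deltaConj _ (permBar_pureGen (by omega) (by omega))

theorem crossing_latticeElt (hA : Admissible P) {i : LatticeIndex P} (hi : ¬ i.IsPower) :
    crossing (latticeElt P i) = (2 * order P : ℤ) • edge (pairOf i) := by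
  rcases i with ⟨j, h, k⟩ | ⟨a, b, hab, k⟩
  · have hle := offset_add_le_strands (P := P) j
    have h3 := hA.three_le j
    have hh2 := h.2
    simp only [latticeElt, LatticeIndex.IsPower, pairOf, innerBase] at hi ⊢
    by_cases hh : (h : ℕ) = 0
    · have hk : (k : ℕ) ≠ 0 := fun hk => hi ⟨hh, hk⟩
      rw [if_pos hh, if_neg hk, crossing_deltaConj hA _ (permBar_pureGen (by omega) (by omega))
        (crossing_pureGen_pt (a := j) (b := j) (u := 1) (v := 2) (by omega) (by omega) (by omega)
          (by omega) (by omega)), if_pos hh, hh, Nat.cast_sub (by omega)]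
      -- The generator with index `k ≥ 1` starts at the pair `{1, 2}` and is moved by `δ^(k-1)`. As
      -- a function of `k` this is base point `2` moved `k` steps; the value `k = 0` then marks the
      -- one adjacent pair left for `x_j^{P_j}`.
      have e1 : ((1 : ℕ) : ZMod (P j)) - (((k : ℕ) : ZMod (P j)) - ((1 : ℕ) : ZMod (P j))) =
          ((2 : ℕ) : ZMod (P j)) - ((k : ℕ) : ZMod (P j)) := by push_cast; ring
      have e2 : ((2 : ℕ) : ZMod (P j)) - (((k : ℕ) : ZMod (P j)) - ((1 : ℕ) : ZMod (P j))) =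
          ((2 : ℕ) : ZMod (P j)) - ((k : ℕ) : ZMod (P j)) + ((0 + 1 : ℕ) : ZMod (P j)) := by
        push_cast; ring
      rw [e1, e2]
    · rw [if_neg hh, crossing_deltaConj hA _ (permBar_pureGen (by omega) (by omega))
        (crossing_pureGen_pt (a := j) (b := j) (u := 0) (v := h + 1) (by omega) (by omega)
          (by omega) (by omega) (by omega)), if_neg hh]
      congr 5
      ring
  · have hle := offset_add_le_strands (P := P) a
    have hle' := offset_add_le_offset (P := P) hab
    have h3 := hA.three_le a
    have h3' := hA.three_le b
    have hle'' := offset_add_le_strands (P := P) b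
    simp only [latticeElt, pairOf]
    rw [crossing_deltaConj hA _ (permBar_pureGen (by omega) (by omega))
        (crossing_pureGen_pt (a := a) (b := b) (u := 0) (v := 0) (by omega) (by omega) (by omega)
          (by omega) (by omega)), Nat.cast_zero, Nat.cast_zero, zero_sub, zero_sub]

theorem orbitSum_one_eq {j : Fin t} {h : Fin ((P j - 1) / 2)} (hh : (h : ℕ) = 0) :
    orbitSum j 1 = ∑ k : Fin (P j), edge (pairOf (.inner j h k)) := by
  let F : ZMod (P j) → Sym2 (Fin (strands P)) → ℤ := fun k =>
    edge s(pt j (((innerBase h : ℕ) : ZMod (P j)) - k),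
      pt j (((innerBase h : ℕ) : ZMod (P j)) - k + (((h : ℕ) + 1 : ℕ) : ZMod (P j))))
  refine Eq.symm ((Finset.sum_range fun k : ℕ => F (k : ZMod (P j))).symm.trans ?_)
  rw [sum_range_natCast]
  refine Fintype.sum_equiv (Equiv.subLeft ((innerBase h : ℕ) : ZMod (P j))) _ _ fun k => ?_
  simp only [F]
  rw [hh, zero_add, Nat.cast_one]
  rfl

theorem crossing_latticeElt_power (hA : Admissible P) {j : Fin t} {h : Fin ((P j - 1) / 2)}
    {k : Fin (P j)} (hh : (h : ℕ) = 0) (hk : (k : ℕ) = 0) :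
    crossing (latticeElt P (.inner j h k)) =
      ∑ k : Fin (P j), (2 : ℤ) • edge (pairOf (.inner j h k)) := by
  rw [latticeElt_power_eq hh hk, crossing_rotElt_pow hA, orbitSum_one_eq hh, Finset.smul_sum]

theorem edge_pairOf_apply (hA : Admissible P) {i i' : LatticeIndex P} (h : i ≠ i') :
    edge (pairOf i) (pairOf i') = 0 := by
  rw [edge_apply, if_neg]
  exact fun h' => h (pairOf_injective hA h').symm

theorem finite_latticeIndex (hA : Admissible P) : Finite (LatticeIndex P) :=
  Finite.of_injective _ (pairOf_injective hA)

theorem commute_latticeElt (hA : Admissible P) (i i' : LatticeIndex P) :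
    Commute (latticeElt P i) (latticeElt P i') :=
  commute_of_permBar_eq_one (permBar_latticeElt hA i) (permBar_latticeElt hA i')

/-- The pair attached to `x_j^{P_j}` is seen by no other generator, which makes the crossing matrix
triangular. -/
theorem crossing_latticeElt_apply_power (hA : Admissible P) {i i₀ : LatticeIndex P}
    (hi₀ : i₀.IsPower) (hne : i ≠ i₀) : crossing (latticeElt P i) (pairOf i₀) = 0 := by
  by_cases hi : i.IsPower
  · rcases i with ⟨j, h, k⟩ | _
    · rw [crossing_latticeElt_power hA hi.1 hi.2, Finset.sum_apply]
      refine Finset.sum_eq_zero fun k' _ => ?_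
      rw [Pi.smul_apply, edge_pairOf_apply hA, smul_zero]
      rintro rfl
      have : k = k' := Fin.ext (hi.2.trans hi₀.2.symm)
      exact hne (by rw [this])
    · exact hi.elim
  · rw [crossing_latticeElt hA hi, Pi.smul_apply, edge_pairOf_apply hA hne, smul_zero]

theorem crossing_latticeElt_apply_self (hA : Admissible P) (i : LatticeIndex P) :
    crossing (latticeElt P i) (pairOf i) ≠ 0 := by
  by_cases hi : i.IsPower
  · rcases i with ⟨j, h, k⟩ | _
    · rw [crossing_latticeElt_power hA hi.1 hi.2, Finset.sum_apply, Finset.sum_eq_single k]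
      · rw [Pi.smul_apply, edge_eq_iff_apply.2 rfl]
        decide
      · intro k' _ hk'
        rw [Pi.smul_apply, edge_pairOf_apply hA, smul_zero]
        intro h'
        injection h' with _ _ h'
        exact hk' h'
      · simp
    · exact hi.elim
  · have := order_pos hA
    rw [crossing_latticeElt hA hi, Pi.smul_apply, edge_eq_iff_apply.2 rfl, smul_eq_mul, mul_one]
    omega

/-- The lattice generators are linearly independent. -/
theorem powHom_latticeElt_injective (hA : Admissible P) [Fintype (LatticeIndex P)] :
    Function.Injective (powHom (latticeElt P) (commute_latticeElt hA)) := by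
  rw [injective_iff_map_eq_one]
  intro f hf
  have h0 : ∀ i₀, ∑ i, (f i).toAdd * crossing (latticeElt P i) (pairOf i₀) = 0 := by
    intro i₀
    have := crossing_powHom (hc := commute_latticeElt hA) (permBar_latticeElt hA) f
    rw [hf, crossing_one] at this
    have := congrFun this (pairOf i₀)
    rw [Finset.sum_apply] at this
    simpa using this.symm
  have hone : ∀ i₀ : LatticeIndex P, (∀ i, i ≠ i₀ →
      (f i).toAdd * crossing (latticeElt P i) (pairOf i₀) = 0) → (f i₀).toAdd = 0 := by
    intro i₀ h
    have h1 := h0 i₀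
    rw [Finset.sum_eq_single i₀ (fun i _ => h i) (by simp)] at h1
    exact (mul_eq_zero.1 h1).resolve_right (crossing_latticeElt_apply_self hA i₀)
  -- The exponents of the `x_j^{P_j}` vanish first; without them the crossing matrix is diagonal.
  have hpow : ∀ i : LatticeIndex P, i.IsPower → (f i).toAdd = 0 := fun i₀ hi₀ =>
    hone i₀ fun i hi => by rw [crossing_latticeElt_apply_power hA hi₀ hi, mul_zero]
  funext i₀
  refine hone i₀ fun i hi => ?_
  by_cases hip : i.IsPower
  · rw [hpow i hip, zero_mul]
  · rw [crossing_latticeElt hA hip, Pi.smul_apply, edge_pairOf_apply hA hi, smul_zero, mul_zero]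

end Lattice

/-! ### The relations hold in the braid quotient -/

section Presentation

variable {t : ℕ} {P : Fin t → ℕ}

variable (P) in
/-- The images of the generating symbols. -/
def genImage : PresGen P → BraidQuot (strands P) := Sum.elim (latticeElt P) (rotElt P)

variable [hP : ∀ j, NeZero (P j)]

theorem act_shift_edge_of_ne {i j : Fin t} (hij : j ≠ i) (x y : ZMod (P j)) :
    act (shift P (unit i)) (edge s(pt j x, pt j y)) = edge s(pt j x, pt j y) := by
  rw [act_edge, shift_smul, toAdd_unit_of_ne hij, Int.cast_zero, sub_zero, sub_zero]

theorem act_crossing_rotElt (hA : Admissible P) {i j : Fin t} (hij : j ≠ i) :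
    act (shift P (unit i)) (crossing (rotElt P j)) = crossing (rotElt P j) := by
  rw [crossing_rotElt hA, crossing_delta hA]
  simp only [map_add, map_sum, map_zsmul, act_shift_edge_of_ne hij]

/-- All crossings of `x_j` are between strings of block `j`, so rotating another block leaves them
unchanged. -/
theorem commute_rotElt (hA : Admissible P) (i j : Fin t) : Commute (rotElt P i) (rotElt P j) := by
  by_cases hij : i = j
  · rw [hij]
  · apply eq_of_crossing_eq
    · rw [map_mul, map_mul, permBar_rotElt hA, permBar_rotElt hA, ← map_mul, ← map_mul, mul_comm]
    · rw [crossing_mul, crossing_mul, permBar_rotElt hA, permBar_rotElt hA,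
        act_crossing_rotElt hA hij, act_crossing_rotElt hA (Ne.symm hij), add_comm]

/-- Generators other than the `x_j^{P_j}` all have the same weight `2q` on a single pair, so
conjugation merely follows the motion of that pair. -/
theorem conj_latticeElt (hA : Admissible P) {g : BraidQuot (strands P)}
    {f : Fin t → Multiplicative ℤ} (hg : permBar (strands P) g = shift P f)
    {i i' : LatticeIndex P} (hi : ¬ i.IsPower) (hi' : ¬ i'.IsPower)
    (h : shift P f • pairOf i = pairOf i') :
    g * latticeElt P i * g⁻¹ = latticeElt P i' := by
  apply eq_of_crossing_eq
  · rw [permBar_conj _ (permBar_latticeElt hA i), permBar_latticeElt hA]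
  · rw [crossing_conj _ (permBar_latticeElt hA i), hg, crossing_latticeElt hA hi,
      crossing_latticeElt hA hi', map_zsmul, act_edge, h]

theorem shift_unit_smul_inner (j : Fin t) (h : Fin ((P j - 1) / 2)) (k : Fin (P j)) :
    shift P (unit j) • pairOf (.inner j h k) = pairOf (.inner j h (finRotate (P j) k)) := by
  simp only [pairOf]
  rw [shift_smul, toAdd_unit_self, natCast_finRotate dvd_rfl, Int.cast_one, sub_sub,
    add_sub_right_comm, sub_sub]

theorem shift_unit_smul_inner_of_ne {i j : Fin t} (hij : i ≠ j) (h : Fin ((P j - 1) / 2))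
    (k : Fin (P j)) : shift P (unit i) • pairOf (.inner j h k) = pairOf (.inner j h k) := by
  simp only [pairOf]
  rw [shift_smul, toAdd_unit_of_ne hij.symm, Int.cast_zero, sub_zero, sub_zero]

theorem shift_unit_smul_cross_of_ne {i a b : Fin t} (hab : a < b) (hia : i ≠ a) (hib : i ≠ b)
    (k : Fin (P a * P b)) :
    shift P (unit i) • pairOf (.cross a b hab k) = pairOf (.cross a b hab k) := by
  simp only [pairOf]
  rw [shift_smul, toAdd_unit_of_ne hia.symm, toAdd_unit_of_ne hib.symm, Int.cast_zero, Int.cast_zero,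
    sub_zero, sub_zero]

theorem shift_unit_mul_smul_cross {a b : Fin t} (hab : a < b) (k : Fin (P a * P b)) :
    shift P (unit a * unit b) • pairOf (.cross a b hab k) =
      pairOf (.cross a b hab (finRotate (P a * P b) k)) := by
  simp only [pairOf]
  rw [shift_smul, Pi.mul_apply, Pi.mul_apply, toAdd_mul, toAdd_mul, toAdd_unit_self,
    toAdd_unit_self, toAdd_unit_of_ne hab.ne, toAdd_unit_of_ne hab.ne',
    natCast_finRotate (dvd_mul_right _ _), natCast_finRotate (dvd_mul_left _ _)]
  simp [sub_eq_add_neg, add_comm]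

theorem crossing_list_prod {n : ℕ} (L : List (BraidQuot n)) (hL : ∀ g ∈ L, permBar n g = 1) :
    permBar n L.prod = 1 ∧ crossing L.prod = (L.map crossing).sum := by
  induction L with
  | nil => simp [crossing_one]
  | cons g L ih =>
    obtain ⟨h1, h2⟩ := ih fun g hg => hL g (List.mem_cons_of_mem _ hg)
    have hg := hL g List.mem_cons_self
    rw [List.prod_cons, map_mul, hg, h1, one_mul, crossing_mul_of_perm hg, h2, List.map_cons,
      List.sum_cons]
    exact ⟨rfl, rfl⟩

theorem sum_map_filter_finRange {M : Type*} [AddCommMonoid M] {N : ℕ} (p : Fin N → Bool)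
    (f : Fin N → M) :
    (((List.finRange N).filter p).map f).sum = ∑ l, if p l then f l else 0 := by
  rw [Fin.sum_univ_def]
  induction List.finRange N with
  | nil => rfl
  | cons x L ih =>
    by_cases hx : p x <;> simp [hx, ih]

/-- The last case of the action of `x_j` on its block. -/
theorem conj_latticeElt_last (hA : Admissible P) {j : Fin t} {h : Fin ((P j - 1) / 2)}
    {k k₀ : Fin (P j)} (hh : (h : ℕ) = 0) (hk : (k : ℕ) + 1 = P j) (hk₀ : (k₀ : ℕ) = 0) :
    rotElt P j * latticeElt P (.inner j h k) * (rotElt P j)⁻¹ =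
      latticeElt P (.inner j h k₀) ^ order P *
        (((List.finRange (P j)).filter (fun l : Fin (P j) => decide (0 < (l : ℕ)))).map
          (fun l : Fin (P j) => (latticeElt P (.inner j h l))⁻¹)).prod := by
  have h3 := hA.three_le j
  have hV := permBar_latticeElt (P := P) hA
  obtain ⟨hL1, hL2⟩ := crossing_list_prod
    (((List.finRange (P j)).filter (fun l : Fin (P j) => decide (0 < (l : ℕ)))).map
          (fun l : Fin (P j) => (latticeElt P (.inner j h l))⁻¹)) (by
    intro g hg
    obtain ⟨l, _, rfl⟩ := List.mem_map.1 hg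
    rw [map_inv, hV, inv_one])
  have hrot : finRotate (P j) k = k₀ := by
    have h1 := natCast_finRotate (dvd_refl (P j)) k
    have h2 : ((k : ℕ) : ZMod (P j)) + 1 = 0 := by
      rw [← Nat.cast_one, ← Nat.cast_add, hk, ZMod.natCast_self]
    rw [h2, ← Nat.cast_zero] at h1
    exact Fin.ext ((natCast_injOn (Fin.is_lt _) (by omega) h1).trans hk₀.symm)
  apply eq_of_crossing_eq
  · rw [permBar_conj _ (hV _), map_mul, map_pow, hV, one_pow, hL1, one_mul]
  · have hkp : ¬ (LatticeIndex.inner j h k).IsPower := fun hkp => by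
      have := hkp.2
      omega
    -- The left side is `2q` on the pair of `k₀`. On the right, `e_{j,0,1}^q` puts `2q` on every
    -- adjacent pair, and the inverse factors remove it from all of them but that of `k₀`.
    rw [crossing_conj _ (hV _), permBar_rotElt hA, crossing_latticeElt hA hkp, map_zsmul, act_edge,
      shift_unit_smul_inner, crossing_mul_of_perm (by rw [map_pow, hV, one_pow]),
      crossing_pow_of_perm (hV _), hL2, List.map_map, sum_map_filter_finRange,
      crossing_latticeElt_power hA hh hk₀, hrot, Finset.smul_sum, ← Finset.sum_add_distrib,
      Finset.sum_eq_single k₀]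
    · rw [if_neg (by simp [hk₀]), add_zero, ← natCast_zsmul, smul_smul, mul_comm]
    · intro l _ hl
      have hl0 : 0 < (l : ℕ) := Nat.pos_of_ne_zero fun h0 => hl (Fin.ext (h0.trans hk₀.symm))
      have hlp : ¬ (LatticeIndex.inner j h l).IsPower := fun hlp => hl0.ne' hlp.2
      rw [if_pos (by simpa using hl0), Function.comp_apply, crossing_inv, hV, inv_one, act_one,
        crossing_latticeElt hA hlp, ← natCast_zsmul, smul_smul, mul_comm, add_neg_cancel]
    · simp

theorem rot_conj_of_ne (hA : Admissible P) {i j : Fin t} (hij : i ≠ j) (h : Fin ((P j - 1) / 2))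
    (k : Fin (P j)) :
    rotElt P i * latticeElt P (.inner j h k) * (rotElt P i)⁻¹ = latticeElt P (.inner j h k) := by
  by_cases hp : (LatticeIndex.inner j h k).IsPower
  · rw [latticeElt_power_eq hp.1 hp.2, ((commute_rotElt hA i j).pow_right _).eq,
      mul_inv_cancel_right]
  · exact conj_latticeElt hA (permBar_rotElt hA i) hp hp (shift_unit_smul_inner_of_ne hij h k)

/-- The relations of the presentation hold in `B_n / [P_n, P_n]`. -/
theorem lift_genImage_eq (hA : Admissible P) {u v : FreeGroup (PresGen P)} (h : PresRel P u v) :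
    FreeGroup.lift (genImage P) u = FreeGroup.lift (genImage P) v := by
  have hE : ∀ i, FreeGroup.lift (genImage P) (symE P i) = latticeElt P i := fun i => by
    rw [symE, FreeGroup.lift_apply_of]; rfl
  have hX : ∀ j, FreeGroup.lift (genImage P) (symX P j) = rotElt P j := fun i => by
    rw [symX, FreeGroup.lift_apply_of]; rfl
  cases h with
  | lattice_comm i i' => simp only [map_mul, hE]; exact commute_latticeElt hA i i'
  | rot_comm i j => simp only [map_mul, hX]; exact commute_rotElt hA i j
  | power j h k hh hk => rw [map_pow, hX, hE, latticeElt_power_eq hh hk]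
  | conj_first j h k hh hk =>
    simp only [map_mul, map_inv, hE, hX]
    rw [latticeElt_power_eq hh hk, ((Commute.refl _).pow_right _).eq, mul_inv_cancel_right]
  | conj_zero j h k hh hk hk' =>
    simp only [map_mul, map_inv, hE, hX]
    refine conj_latticeElt hA (permBar_rotElt hA j) (fun hp => ?_) (fun hp => ?_)
      (shift_unit_smul_inner j h k)
    · have := hp.2; omega
    · have := hp.2
      rw [val_finRotate hk'] at this
      omega
  | conj_last j h k k₀ hh hk hk₀ =>
    simp only [map_mul, map_inv, map_pow, map_list_prod, List.map_map, Function.comp_def, hE, hX]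
    exact conj_latticeElt_last hA hh hk hk₀
  | conj_pos j h k hh =>
    simp only [map_mul, map_inv, hE, hX]
    refine conj_latticeElt hA (permBar_rotElt hA j) (fun hp => ?_) (fun hp => ?_)
      (shift_unit_smul_inner j h k) <;> · have := hp.1; omega
  | conj_cross a b hab k =>
    simp only [map_mul, map_inv, hE, hX]
    refine conj_latticeElt hA ?_ id id (shift_unit_mul_smul_cross hab k)
    rw [map_mul, permBar_rotElt hA, permBar_rotElt hA, map_mul]
  | conj_inner_other i j hij h k =>
    simp only [map_mul, map_inv, hE, hX]
    exact rot_conj_of_ne hA hij h k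
  | conj_cross_other i a b hab hia hib k =>
    simp only [map_mul, map_inv, hE, hX]
    exact conj_latticeElt hA (permBar_rotElt hA i) id id (shift_unit_smul_cross_of_ne hab hia hib k)

end Presentation

/-! ### The presented group embeds -/

section PresentedExtension

variable {t : ℕ} {P : Fin t → ℕ}

variable (P) in
/-- The presented group. -/
abbrev PresGroup : Type := PresentedGroup (presRelators P)

/-- The class of the letter of a lattice generator. -/
def genE (i : LatticeIndex P) : PresGroup P := PresentedGroup.of (Sum.inl i)

/-- The class of the letter of `x_j`. -/
def genX (j : Fin t) : PresGroup P := PresentedGroup.of (Sum.inr j)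

theorem mk_eq_of_presRel {u v : FreeGroup (PresGen P)} (h : PresRel P u v) :
    PresentedGroup.mk (presRelators P) u = PresentedGroup.mk (presRelators P) v :=
  PresentedGroup.mk_eq_mk_of_mul_inv_mem ⟨u, v, h, rfl⟩

variable (P) in
/-- The subgroup generated by the lattice generators. -/
def latticeSubgroup : Subgroup (PresGroup P) := Subgroup.closure (Set.range genE)

theorem genE_mem (i : LatticeIndex P) : genE i ∈ latticeSubgroup P :=
  Subgroup.subset_closure ⟨i, rfl⟩

theorem commute_genE (i i' : LatticeIndex P) : Commute (genE i) (genE i') :=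
  mk_eq_of_presRel (.lattice_comm i i')

theorem commute_genX (i j : Fin t) : Commute (genX (P := P) i) (genX j) :=
  mk_eq_of_presRel (.rot_comm i j)

theorem commute_of_mem_latticeSubgroup {l : PresGroup P} (hl : l ∈ latticeSubgroup P)
    (i : LatticeIndex P) : Commute l (genE i) := by
  have : latticeSubgroup P ≤ Subgroup.centralizer {genE i} := by
    rw [latticeSubgroup, Subgroup.closure_le]
    rintro _ ⟨i', rfl⟩
    rw [SetLike.mem_coe, Subgroup.mem_centralizer_singleton_iff]
    exact commute_genE i' i
  have := this hl
  rw [Subgroup.mem_centralizer_singleton_iff] at this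
  exact this

theorem genX_pow_mem (hA : Admissible P) (j : Fin t) : genX j ^ P j ∈ latticeSubgroup P := by
  have h3 := hA.three_le j
  have := mk_eq_of_presRel (.power (P := P) j ⟨0, by omega⟩ ⟨0, by omega⟩ rfl rfl)
  rw [map_pow] at this
  exact (show genX j ^ P j = genE _ from this) ▸ genE_mem _

/-- A lattice factor next to the generator commutes with it, so it does not affect the conjugate. -/
theorem conj_mem_of_eq_mul {x l : PresGroup P} (hl : l ∈ latticeSubgroup P) {i : LatticeIndex P}
    (h : (x * l) * genE i * (x * l)⁻¹ ∈ latticeSubgroup P) :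
    x * genE i * x⁻¹ ∈ latticeSubgroup P := by
  have hc := (commute_of_mem_latticeSubgroup hl i).eq
  convert h using 1
  rw [mul_inv_rev, mul_assoc x l, hc]
  group

theorem conj_pow_cross {a b : Fin t} (hab : a < b) (m : ℕ) (k : Fin (P a * P b)) :
    (genX a * genX b) ^ m * genE (.cross a b hab k) * ((genX a * genX b) ^ m)⁻¹ ∈
      latticeSubgroup P := by
  induction m generalizing k with
  | zero => simpa using genE_mem _
  | succ m ih =>
    have h : genX a * genX b * genE (.cross a b hab k) * (genX a * genX b)⁻¹ =
        genE (.cross a b hab (finRotate (P a * P b) k)) := by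
      have := mk_eq_of_presRel (.conj_cross a b hab k)
      simp only [map_mul, map_inv] at this
      exact this
    have := ih (finRotate (P a * P b) k)
    rw [← h] at this
    convert this using 1
    rw [pow_succ]
    group

theorem genX_pow_eq (hA : Admissible P) (j : Fin t) {m : ℕ} (hm : m ≡ 1 [MOD P j]) :
    ∃ l ∈ latticeSubgroup P, genX j ^ m = genX j * l := by
  have h3 := hA.three_le j
  have hm1 : m % P j = 1 := by
    rw [hm, Nat.mod_eq_of_lt (by omega)]
  refine ⟨(genX j ^ P j) ^ (m / P j), pow_mem (genX_pow_mem hA j) _, ?_⟩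
  conv_lhs => rw [← Nat.mod_add_div m (P j), hm1, pow_add, pow_one, pow_mul]

theorem genX_pow_mem_of_dvd (hA : Admissible P) (j : Fin t) {m : ℕ} (hm : m ≡ 0 [MOD P j]) :
    genX j ^ m ∈ latticeSubgroup P := by
  obtain ⟨k, rfl⟩ := (Nat.modEq_zero_iff_dvd).1 hm
  rw [pow_mul]
  exact pow_mem (genX_pow_mem hA j) _

/-- The relations describe conjugation by `x_a x_b` on the cross family, not by `x_a` or `x_b`
alone. A suitable power of `x_a x_b` equals either factor up to lattice elements. -/
theorem genX_conj_mem (hA : Admissible P) (j : Fin t) (i : LatticeIndex P) :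
    genX j * genE i * (genX j)⁻¹ ∈ latticeSubgroup P := by
  have hfix : ∀ {i'}, PresRel P (symX P j * symE P i * (symX P j)⁻¹) (symE P i') →
      genX j * genE i * (genX j)⁻¹ ∈ latticeSubgroup P := by
    intro i' h
    have := mk_eq_of_presRel h
    simp only [map_mul, map_inv] at this
    exact (show genX j * genE i * (genX j)⁻¹ = genE i' from this) ▸ genE_mem i'
  rcases i with ⟨j', h, k⟩ | ⟨a, b, hab, k⟩
  · by_cases hj : j = j'
    · subst hj
      by_cases hh : (h : ℕ) = 0
      · by_cases hk : (k : ℕ) = 0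
        · exact hfix (.conj_first j h k hh hk)
        · by_cases hk' : (k : ℕ) + 1 < P j
          · exact hfix (.conj_zero j h k hh (by omega) hk')
          · have := mk_eq_of_presRel
              (.conj_last j h k ⟨0, by omega⟩ hh (by omega) rfl)
            simp only [map_mul, map_inv, map_pow, map_list_prod, List.map_map,
              Function.comp_def] at this
            change genX j * genE (.inner j h k) * (genX j)⁻¹ = _ at this
            rw [this]
            refine mul_mem (pow_mem (genE_mem _) _) (Subgroup.list_prod_mem _ ?_)
            intro g hg
            obtain ⟨l, _, rfl⟩ := List.mem_map.1 hg
            exact inv_mem (genE_mem _)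
      · exact hfix (.conj_pos j h k (by omega))
    · exact hfix (.conj_inner_other j j' hj h k)
  · have hco := hA.coprime hab.ne
    have hpow := (commute_genX (P := P) a b).mul_pow
    by_cases hja : j = a
    · subst hja
      -- With `m ≡ 1` modulo `P_a` and `m ≡ 0` modulo `P_b`, both `x_a^m x_a⁻¹` and `x_b^m` lie in
      -- the lattice.
      obtain ⟨m, hm1, hm2⟩ := Nat.chineseRemainder hco 1 0
      obtain ⟨l, hl, hl'⟩ := genX_pow_eq hA j hm1
      refine conj_mem_of_eq_mul (mul_mem hl (genX_pow_mem_of_dvd hA b hm2)) ?_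
      have := conj_pow_cross hab m k
      rwa [hpow, hl', mul_assoc (genX j) l] at this
    · by_cases hjb : j = b
      · subst hjb
        obtain ⟨m, hm1, hm2⟩ := Nat.chineseRemainder hco 0 1
        obtain ⟨l, hl, hl'⟩ := genX_pow_eq hA j hm2
        refine conj_mem_of_eq_mul (mul_mem hl (genX_pow_mem_of_dvd hA a hm1)) ?_
        have := conj_pow_cross hab m k
        rwa [hpow, ((commute_genX a j).pow_pow m m).eq, hl', mul_assoc (genX j) l] at this
      · exact hfix (.conj_cross_other j a b hab hja hjb k)

theorem closure_gens : Subgroup.closure (Set.range genE ∪ Set.range genX) =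
    (⊤ : Subgroup (PresGroup P)) := by
  rw [eq_top_iff, ← PresentedGroup.closure_range_of, Subgroup.closure_le]
  rintro _ ⟨i | j, rfl⟩
  · exact Subgroup.subset_closure (Or.inl ⟨i, rfl⟩)
  · exact Subgroup.subset_closure (Or.inr ⟨j, rfl⟩)

theorem latticeSubgroup_normal (hA : Admissible P) : (latticeSubgroup P).Normal := by
  refine normal_of_conj_gens (S := Set.range genE) rfl closure_gens ?_ ?_
  · rintro _ (⟨i, rfl⟩ | ⟨j, rfl⟩) _ ⟨i', rfl⟩
    · exact mul_mem (mul_mem (genE_mem _) (genE_mem _)) (inv_mem (genE_mem _))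
    · exact genX_conj_mem hA j i'
  · rintro _ (⟨i, rfl⟩ | ⟨j, rfl⟩)
    · exact ⟨0, by simpa using genE_mem i⟩
    · have h3 := hA.three_le j
      refine ⟨P j - 1, ?_⟩
      rw [Nat.sub_add_cancel (by omega)]
      exact genX_pow_mem hA j

/-- Since the lattice is normal, its product with the abelian subgroup of the `x_j` is a subgroup;
it contains all generators. -/
theorem exists_mul_powHom (hA : Admissible P) (w : PresGroup P) :
    ∃ l ∈ latticeSubgroup P, ∃ f, w = l * powHom (genX (P := P)) commute_genX f := by
  have := latticeSubgroup_normal hA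
  have hw : w ∈ latticeSubgroup P ⊔ (powHom (genX (P := P)) commute_genX).range := by
    rw [range_powHom, latticeSubgroup, ← Subgroup.closure_union, closure_gens]
    exact Subgroup.mem_top w
  rw [Subgroup.mem_sup_of_normal_left] at hw
  obtain ⟨l, hl, _, ⟨f, rfl⟩, rfl⟩ := hw
  exact ⟨l, hl, f, rfl⟩

variable [hP : ∀ j, NeZero (P j)]

/-- The homomorphism from the presented group to `B_n / [P_n, P_n]`. -/
def toBraid (hA : Admissible P) : PresGroup P →* BraidQuot (strands P) :=
  PresentedGroup.toGroup (f := genImage P) (by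
    rintro _ ⟨u, v, h, rfl⟩
    rw [map_mul, map_inv, lift_genImage_eq hA h, mul_inv_cancel])

theorem toBraid_genE (hA : Admissible P) (i : LatticeIndex P) :
    toBraid hA (genE i) = latticeElt P i := PresentedGroup.toGroup.of _

theorem toBraid_genX (hA : Admissible P) (j : Fin t) : toBraid hA (genX j) = rotElt P j :=
  PresentedGroup.toGroup.of _

theorem permBar_toBraid_of_mem (hA : Admissible P) {l : PresGroup P}
    (hl : l ∈ latticeSubgroup P) : permBar (strands P) (toBraid hA l) = 1 := by
  have : latticeSubgroup P ≤ ((permBar (strands P)).comp (toBraid hA)).ker := by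
    rw [latticeSubgroup, Subgroup.closure_le]
    rintro _ ⟨i, rfl⟩
    change permBar (strands P) (toBraid hA (genE i)) = 1
    rw [toBraid_genE, permBar_latticeElt hA]
  exact this hl

theorem permBar_toBraid_powHom (hA : Admissible P) (f : Fin t → Multiplicative ℤ) :
    permBar (strands P) (toBraid hA (powHom (genX (P := P)) commute_genX f)) = shift P f := by
  refine DFunLike.congr_fun
    (f := ((permBar (strands P)).comp (toBraid hA)).comp (powHom (genX (P := P)) commute_genX))
    (g := shift P) (MonoidHom.pi_ext fun j m => ?_) f
  simp only [MonoidHom.comp_apply]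
  rw [powHom_mulSingle, map_zpow, map_zpow, toBraid_genX, permBar_rotElt hA, ← map_zpow, unit,
    ← Pi.mulSingle_zpow, ← ofAdd_zsmul, smul_eq_mul, mul_one, ofAdd_toAdd]

theorem shift_eq_one_iff (f : Fin t → Multiplicative ℤ) :
    shift P f = 1 ↔ ∀ j, (P j : ℤ) ∣ (f j).toAdd := by
  simp only [← ZMod.intCast_zmod_eq_zero_iff_dvd]
  constructor
  · intro h j
    have := DFunLike.congr_fun h (pt j 0)
    rw [shift_pt, Equiv.Perm.one_apply] at this
    simpa using pt_injective j this
  · intro h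
    ext x
    obtain ⟨j, y, rfl⟩ := exists_pt x
    rw [shift_pt, h, sub_zero, Equiv.Perm.one_apply]

/-- The lattice subgroup is the kernel of the action on the strings. -/
theorem mem_latticeSubgroup (hA : Admissible P) {w : PresGroup P}
    (hw : permBar (strands P) (toBraid hA w) = 1) : w ∈ latticeSubgroup P := by
  obtain ⟨l, hl, f, rfl⟩ := exists_mul_powHom hA w
  rw [map_mul, map_mul, permBar_toBraid_of_mem hA hl, one_mul, permBar_toBraid_powHom,
    shift_eq_one_iff] at hw
  -- Every exponent is now a multiple of `P_j`, and `x_j^{P_j}` is a lattice symbol.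
  refine mul_mem hl (powHom_mem fun j => ?_)
  obtain ⟨m, hm⟩ := hw j
  rw [hm, zpow_mul, zpow_natCast]
  exact zpow_mem (genX_pow_mem hA j) m

/-- The kernel acts trivially on the strings, so it lies in the lattice, where the independence of
the images leaves no room for it. -/
theorem toBraid_injective (hA : Admissible P) : Function.Injective (toBraid hA) := by
  have := finite_latticeIndex hA
  have := Fintype.ofFinite (LatticeIndex P)
  rw [injective_iff_map_eq_one]
  intro w hw
  have hmem := mem_latticeSubgroup hA (w := w) (by rw [hw, map_one])
  rw [latticeSubgroup, ← range_powHom (hv := commute_genE)] at hmem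
  obtain ⟨f, rfl⟩ := hmem
  rw [map_powHom (toBraid hA) (commute_latticeElt hA) (toBraid_genE hA)] at hw
  rw [(injective_iff_map_eq_one _).1 (powHom_latticeElt_injective hA) f hw, map_one]

theorem latticeElt_mem_range (hA : Admissible P) (i : LatticeIndex P) :
    latticeElt P i ∈ (toBraid hA).range := ⟨_, toBraid_genE hA i⟩

theorem rotElt_mem_range (hA : Admissible P) (j : Fin t) : rotElt P j ∈ (toBraid hA).range :=
  ⟨_, toBraid_genX hA j⟩

end PresentedExtension

/-! ### The image `Γ_q`, the holonomy group and the exact sequence -/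

section Extension

variable {t : ℕ} {P : Fin t → ℕ}

theorem Admissible.neZero (hA : Admissible P) (j : Fin t) : NeZero (P j) :=
  ⟨by have := hA.three_le j; omega⟩

theorem rotElt_mem_Gamma (j : Fin t) : rotElt P j ∈ Gamma P :=
  Subgroup.subset_closure (Or.inl ⟨j, rfl⟩)

variable [hP : ∀ j, NeZero (P j)]

theorem pureGen_pow_mem_range (hA : Admissible P) {a b : ℕ} (ha : 1 ≤ a) (hab : a < b)
    (hb : b ≤ strands P) : pureGen (strands P) a b ^ order P ∈ (toBraid hA).range := by
  have hperm : permBar (strands P) (pureGen (strands P) a b) = 1 :=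
    permBar_pureGen ha (by omega)
  obtain ⟨i, hi⟩ := exists_pairOf hA s((⟨a - 1, by omega⟩ : Fin (strands P)), ⟨b - 1, by omega⟩)
    (by rw [Sym2.mk_isDiag_iff, Fin.mk.injEq]; omega)
  have hcr : crossing (pureGen (strands P) a b ^ order P) =
      (2 * order P : ℤ) • edge (pairOf i) := by
    rw [crossing_pow_of_perm hperm, crossing_pureGen ha hab hb, natEdge_mk (by omega) (by omega),
      hi, ← natCast_zsmul, smul_smul, mul_comm]
  have hpow : permBar (strands P) (pureGen (strands P) a b ^ order P) = 1 := by
    rw [map_pow, hperm, one_pow]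
  by_cases hip : i.IsPower
  · rcases i with ⟨j, h, k⟩ | _
    · have h3 := hA.three_le j
      -- The pair is the one reserved for `x_j^{P_j}`, whose `q`-th power `A_{a,b}^q` is not in the
      -- basis. It is reached by rotating the preceding pair, that of `e_{j,0,P_j}`, with `x_j`.
      obtain ⟨k', rfl⟩ := (finRotate (P j)).surjective k
      have hk' : ¬ (LatticeIndex.inner j h k').IsPower := fun hk' => by
        have h1 := hk'.2
        have h2 := hip.2
        rw [val_finRotate (by omega)] at h2
        omega
      have : pureGen (strands P) a b ^ order P =
          rotElt P j * latticeElt P (.inner j h k') * (rotElt P j)⁻¹ := by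
        apply eq_of_crossing_eq
        · rw [hpow, permBar_conj _ (permBar_latticeElt hA _)]
        · rw [hcr, crossing_conj _ (permBar_latticeElt hA _), crossing_latticeElt hA hk',
            permBar_rotElt hA, map_zsmul, act_edge, shift_unit_smul_inner]
      rw [this]
      exact mul_mem (mul_mem (rotElt_mem_range hA j) (latticeElt_mem_range hA _))
        (inv_mem (rotElt_mem_range hA j))
    · exact hip.elim
  · have : pureGen (strands P) a b ^ order P = latticeElt P i :=
      eq_of_crossing_eq (hpow.trans (permBar_latticeElt hA i).symm)
        (hcr.trans (crossing_latticeElt hA hip).symm)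
    rw [this]
    exact latticeElt_mem_range hA i

theorem latticeElt_mem_Gamma (hA : Admissible P) (i : LatticeIndex P) :
    latticeElt P i ∈ Gamma P := by
  by_cases hip : i.IsPower
  · rcases i with ⟨j, h, k⟩ | _
    · rw [latticeElt_power_eq hip.1 hip.2]
      exact pow_mem (rotElt_mem_Gamma j) _
    · exact hip.elim
  -- Comparing crossings shows that a conjugate `δ^s A^q δ^{-s}` is itself some `A_{a,b}^q`.
  · have hlt : ∀ x y : Fin (strands P), x < y → pairOf i = s(x, y) →
        latticeElt P i ∈ Gamma P := by
      intro x y hxy h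
      have hp := permBar_pureGen (n := strands P) (i := x + 1) (j := y + 1) (by omega) (by omega)
      have : latticeElt P i = pureGen (strands P) (x + 1) (y + 1) ^ order P := by
        apply eq_of_crossing_eq
        · rw [permBar_latticeElt hA, map_pow, hp, one_pow]
        · rw [crossing_latticeElt hA hip, crossing_pow_of_perm hp,
            crossing_pureGen (by omega) (by omega) (by omega), Nat.add_sub_cancel,
            Nat.add_sub_cancel, natEdge_coe, h, ← natCast_zsmul, smul_smul, mul_comm]
      exact Subgroup.subset_closure (Or.inr ⟨_, _, by omega, by omega, by omega, this⟩)
    have hd := pairOf_not_isDiag hA i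
    cases hs : pairOf i with
    | _ x y =>
      rw [hs, Sym2.mk_isDiag_iff] at hd
      rcases lt_or_gt_of_ne hd with h | h
      · exact hlt x y h hs
      · exact hlt y x h (hs.trans Sym2.eq_swap)

theorem range_toBraid (hA : Admissible P) : (toBraid hA).range = Gamma P := by
  apply le_antisymm
  · rw [MonoidHom.range_eq_map, ← closure_gens, MonoidHom.map_closure, Subgroup.closure_le]
    rintro _ ⟨_, (⟨i, rfl⟩ | ⟨j, rfl⟩), rfl⟩
    · rw [toBraid_genE]
      exact latticeElt_mem_Gamma hA i
    · rw [toBraid_genX]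
      exact rotElt_mem_Gamma j
  · rw [Gamma, Subgroup.closure_le]
    rintro _ (⟨j, rfl⟩ | ⟨a, b, ha, hab, hb, rfl⟩)
    · exact rotElt_mem_range hA j
    · exact pureGen_pow_mem_range hA ha hab hb

/-- The presentation of `Γ_q`. -/
noncomputable def presEquiv (hA : Admissible P) : PresGroup P ≃* Gamma P :=
  (MonoidHom.ofInjective (toBraid_injective hA)).trans (MulEquiv.subgroupCongr (range_toBraid hA))

theorem coe_presEquiv (hA : Admissible P) (w : PresGroup P) :
    (presEquiv hA w : BraidQuot (strands P)) = toBraid hA w := rfl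

theorem permBar_deltaTotal_zpow (hA : Admissible P) (m : ℤ) :
    permBar (strands P) (deltaTotal P) ^ m = shift P fun _ => Multiplicative.ofAdd m := by
  rw [permBar_deltaTotal hA, ← map_zpow]
  congr 1
  funext j
  rw [Pi.pow_apply, ← ofAdd_zsmul, smul_eq_mul, mul_one]

/-- By the Chinese remainder theorem one power of `δ` realizes prescribed rotations of all the
blocks at once. -/
theorem shift_mem_holonomy (hA : Admissible P) (f : Fin t → Multiplicative ℤ) :
    shift P f ∈ holonomy P := by
  have : NeZero (∏ j, P j) := ⟨(order_pos hA).ne'⟩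
  let z := (ZMod.prodEquivPi P hA.coprime).symm fun j => (((f j).toAdd : ℤ) : ZMod (P j))
  refine Subgroup.mem_zpowers_iff.2 ⟨(z.val : ℤ), ?_⟩
  rw [permBar_deltaTotal_zpow hA, ← mul_inv_eq_one, ← map_inv, ← map_mul, shift_eq_one_iff]
  intro j
  rw [← ZMod.intCast_zmod_eq_zero_iff_dvd, Pi.mul_apply, Pi.inv_apply, toAdd_mul, toAdd_inv,
    toAdd_ofAdd, Int.cast_add, Int.cast_neg, Int.cast_natCast, add_neg_eq_zero]
  have h1 := ZMod.prodEquivPi_apply P hA.coprime z j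
  rw [RingEquiv.apply_symm_apply] at h1
  rw [h1]
  conv_rhs => rw [← ZMod.natCast_zmod_val z]
  rw [map_natCast]

theorem permBar_mem_holonomy (hA : Admissible P) (g : Gamma P) :
    permBar (strands P) g ∈ holonomy P := by
  have : Gamma P ≤ (holonomy P).comap (permBar (strands P)) := by
    rw [← range_toBraid hA]
    rintro _ ⟨w, rfl⟩
    obtain ⟨l, hl, f, rfl⟩ := exists_mul_powHom hA w
    rw [Subgroup.mem_comap, map_mul, map_mul, permBar_toBraid_of_mem hA hl, one_mul,
      permBar_toBraid_powHom]
    exact shift_mem_holonomy hA f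
  exact this g.2

/-- The projection of `Γ_q` to its holonomy group. -/
noncomputable def toHolonomy (hA : Admissible P) : Gamma P →* holonomy P :=
  ((permBar (strands P)).comp (Gamma P).subtype).codRestrict (holonomy P)
    (permBar_mem_holonomy hA)

theorem toHolonomy_surjective (hA : Admissible P) : Function.Surjective (toHolonomy hA) := by
  rintro ⟨s, hs⟩
  obtain ⟨m, rfl⟩ := Subgroup.mem_zpowers_iff.1 hs
  refine ⟨presEquiv hA (powHom genX commute_genX fun _ => Multiplicative.ofAdd m),
    Subtype.ext ?_⟩
  change permBar (strands P) (presEquiv hA _ : BraidQuot (strands P)) = _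
  rw [coe_presEquiv, permBar_toBraid_powHom]
  exact (permBar_deltaTotal_zpow hA m).symm

/-- `δ^m` acts trivially exactly when every `P_j` divides `m`, and the `P_j` are pairwise coprime.
-/
theorem orderOf_permBar_deltaTotal (hA : Admissible P) :
    orderOf (permBar (strands P) (deltaTotal P)) = order P := by
  have key : ∀ m : ℕ, permBar (strands P) (deltaTotal P) ^ m = 1 ↔ order P ∣ m := by
    intro m
    have := permBar_deltaTotal_zpow hA m
    rw [zpow_natCast] at this
    rw [this, shift_eq_one_iff]
    simp only [toAdd_ofAdd, Int.natCast_dvd_natCast]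
    exact ⟨fun h => Fintype.prod_dvd_of_isRelPrime
      (fun i j hij => Nat.coprime_iff_isRelPrime.1 (hA.coprime hij)) h,
      fun h j => (Finset.dvd_prod_of_mem P (Finset.mem_univ j)).trans h⟩
  apply Nat.dvd_antisymm
  · rw [orderOf_dvd_iff_pow_eq_one, key]
  · rw [← key, pow_orderOf_eq_one]

theorem nonempty_holonomy_equiv (hA : Admissible P) :
    Nonempty (holonomy P ≃* Multiplicative (ZMod (order P))) := by
  have hcard : Nat.card (holonomy P) = order P := by
    rw [holonomy, Nat.card_zpowers, orderOf_permBar_deltaTotal hA]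
  have hcyc : IsCyclic (holonomy P) := by unfold holonomy; infer_instance
  have e := (zmodCyclicMulEquiv hcyc).symm
  rw [hcard] at e
  exact ⟨e⟩

/-- Lattice indices are counted by their pairs, of which there are `n` choose `2`. -/
theorem nonempty_rank_equiv (hA : Admissible P) :
    Nonempty (Fin (latticeRank P) ≃ LatticeIndex P) := by
  classical
  let F : LatticeIndex P → {s : Sym2 (Fin (strands P)) // ¬ s.IsDiag} :=
    fun i => ⟨pairOf i, pairOf_not_isDiag hA i⟩
  have hF : Function.Bijective F := by
    constructor
    · intro i j h
      exact pairOf_injective hA (congrArg Subtype.val h)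
    · rintro ⟨s, hs⟩
      obtain ⟨i, hi⟩ := exists_pairOf hA s hs
      exact ⟨i, Subtype.ext hi⟩
  have hcard : Fintype.card {s : Sym2 (Fin (strands P)) // ¬ s.IsDiag} = latticeRank P := by
    rw [Sym2.card_subtype_not_diag, Fintype.card_fin, Nat.choose_two_right, latticeRank]
  exact ⟨((Equiv.ofBijective F hF).trans (Fintype.equivFinOfCardEq hcard)).symm⟩

/-- Reindexing of integral vectors. -/
def reindexHom {ι κ : Type*} (ε : ι ≃ κ) : Multiplicative (ι → ℤ) →* (κ → Multiplicative ℤ) where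
  toFun f i := Multiplicative.ofAdd (f.toAdd (ε.symm i))
  map_one' := rfl
  map_mul' _ _ := rfl

theorem reindexHom_bijective {ι κ : Type*} (ε : ι ≃ κ) : Function.Bijective (reindexHom ε) := by
  constructor
  · intro f g h
    have : f.toAdd = g.toAdd := by
      funext i
      have := congrArg Multiplicative.toAdd (congrFun h (ε i))
      simpa [reindexHom] using this
    exact this
  · intro f
    refine ⟨Multiplicative.ofAdd fun i => (f (ε i)).toAdd, ?_⟩
    funext i
    simp [reindexHom]

theorem reindexHom_single {ι κ : Type*} [DecidableEq ι] [DecidableEq κ] (ε : ι ≃ κ) (i : ι) :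
    reindexHom ε (Multiplicative.ofAdd (Pi.single i 1)) =
      Pi.mulSingle (ε i) (Multiplicative.ofAdd 1) := by
  funext k
  obtain ⟨k, rfl⟩ := ε.surjective k
  by_cases h : k = i
  · subst h
    simp [reindexHom]
  · rw [Pi.mulSingle_eq_of_ne (fun h' => h (ε.injective h'))]
    simp [reindexHom, h]

/-- The extension of `ℤ_q` by the lattice. -/
theorem exists_extension (hA : Admissible P) :
    ∃ (ι : Multiplicative (Fin (latticeRank P) → ℤ) →* Gamma P) (π : Gamma P →* holonomy P)
      (ε : Fin (latticeRank P) ≃ LatticeIndex P),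
      Function.Injective ι ∧ ι.range = π.ker ∧ Function.Surjective π ∧
      (∀ g : Gamma P, (π g : Equiv.Perm (Fin (strands P))) =
        permBar (strands P) (g : BraidQuot (strands P))) ∧
      ∀ i, (ι (Multiplicative.ofAdd (Pi.single i 1)) : BraidQuot (strands P)) =
        latticeElt P (ε i) := by
  classical
  obtain ⟨ε⟩ := nonempty_rank_equiv hA
  have : Fintype (LatticeIndex P) := Fintype.ofEquiv _ ε
  have hbraid : ∀ f, toBraid hA (powHom genE commute_genE f) =
      powHom (latticeElt P) (commute_latticeElt hA) f :=
    fun f => map_powHom (toBraid hA) (commute_latticeElt hA) (toBraid_genE hA) f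
  let ι : Multiplicative (Fin (latticeRank P) → ℤ) →* Gamma P :=
    (presEquiv hA).toMonoidHom.comp ((powHom genE commute_genE).comp (reindexHom ε))
  have hι : ∀ f, (ι f : BraidQuot (strands P)) =
      powHom (latticeElt P) (commute_latticeElt hA) (reindexHom ε f) := fun f => hbraid _
  refine ⟨ι, toHolonomy hA, ε, ?_, ?_, toHolonomy_surjective hA, fun g => rfl, fun i => ?_⟩
  · intro f g h
    have := congrArg (Subtype.val) h
    rw [hι, hι] at this
    exact (reindexHom_bijective ε).1 (powHom_latticeElt_injective hA this)
  -- Exactness is checked in the presented group, where the kernel of the action on the strings is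
  -- the lattice subgroup, the image of `powHom`.
  · ext g
    obtain ⟨w, rfl⟩ := (presEquiv hA).surjective g
    have hker : presEquiv hA w ∈ (toHolonomy hA).ker ↔
        permBar (strands P) (toBraid hA w) = 1 := by
      rw [MonoidHom.mem_ker, Subtype.ext_iff]
      rfl
    rw [hker]
    constructor
    · rintro ⟨f, hf⟩
      rw [← coe_presEquiv, ← hf, hι]
      exact permBar_powHom (permBar_latticeElt hA) _
    · intro h
      have := mem_latticeSubgroup hA h
      rw [latticeSubgroup, ← range_powHom (hv := commute_genE)] at this
      obtain ⟨f, rfl⟩ := this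
      obtain ⟨f, rfl⟩ := (reindexHom_bijective ε).2 f
      exact ⟨f, rfl⟩
  · rw [hι, reindexHom_single, powHom_mulSingle, toAdd_ofAdd, zpow_one]

end Extension

theorem admissible_of_prime_pow {t : ℕ} {p r P : Fin t → ℕ} (hp : ∀ j, (p j).Prime)
    (hodd : ∀ j, Odd (p j)) (hinj : Function.Injective p) (hr : ∀ j, 1 ≤ r j)
    (hP : ∀ j, P j = p j ^ r j) : Admissible P where
  odd j := hP j ▸ (hodd j).pow
  three_le j := by
    rw [hP j]
    have h2 := (hp j).two_le
    obtain ⟨k, hk⟩ := hodd j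
    exact le_trans (by omega) (Nat.le_self_pow (by have := hr j; omega) (p j))
  coprime i j hij := by
    rw [Function.onFun, hP i, hP j]
    exact Nat.Coprime.pow _ _ ((Nat.coprime_primes (hp i) (hp j)).2 fun h => hij (hinj h))

end BraidBieberbach

theorem proposition4p2 (t : ℕ) (p r P : Fin t → ℕ)
    (hp : ∀ j, (p j).Prime) (hodd : ∀ j, Odd (p j)) (hinj : Function.Injective p)
    (hr : ∀ j, 1 ≤ r j) (hP : ∀ j, P j = p j ^ r j) :
    -- the extension, with the lattice generators as a basis of the kernel
    (∃ (ι : Multiplicative (Fin (BraidBieberbach.latticeRank P) → ℤ) →* BraidBieberbach.Gamma P)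
        (π : BraidBieberbach.Gamma P →* BraidBieberbach.holonomy P)
        (ε : Fin (BraidBieberbach.latticeRank P) ≃ BraidBieberbach.LatticeIndex P),
        Function.Injective ι ∧ ι.range = π.ker ∧ Function.Surjective π ∧
        (∀ g : BraidBieberbach.Gamma P,
          (π g : Equiv.Perm (Fin (BraidBieberbach.strands P))) =
            BraidBieberbach.permBar (BraidBieberbach.strands P)
              (g : BraidBieberbach.BraidQuot (BraidBieberbach.strands P))) ∧
        (∀ i, (ι (Multiplicative.ofAdd (Pi.single i 1)) :
            BraidBieberbach.BraidQuot (BraidBieberbach.strands P)) =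
          BraidBieberbach.latticeElt P (ε i))) ∧
    -- the quotient is cyclic of order `q`
    Nonempty (BraidBieberbach.holonomy P ≃* Multiplicative (ZMod (∏ j, p j ^ r j))) ∧
    -- the presentation
    (∃ φ : PresentedGroup (BraidBieberbach.presRelators P) ≃* BraidBieberbach.Gamma P,
        (∀ i : BraidBieberbach.LatticeIndex P,
          (φ (PresentedGroup.of (Sum.inl i)) :
              BraidBieberbach.BraidQuot (BraidBieberbach.strands P)) =
            BraidBieberbach.latticeElt P i) ∧
        (∀ j : Fin t,
          (φ (PresentedGroup.of (Sum.inr j)) :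
              BraidBieberbach.BraidQuot (BraidBieberbach.strands P)) =
            BraidBieberbach.rotElt P j)) := by
  have hA := BraidBieberbach.admissible_of_prime_pow hp hodd hinj hr hP
  have := hA.neZero
  refine ⟨BraidBieberbach.exists_extension hA, ?_, BraidBieberbach.presEquiv hA, fun i => ?_,
    fun j => ?_⟩
  · have := BraidBieberbach.nonempty_holonomy_equiv hA
    rwa [BraidBieberbach.order, Finset.prod_congr rfl fun j _ => hP j] at this
  · exact BraidBieberbach.toBraid_genE hA i
  · exact BraidBieberbach.toBraid_genX hA j
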